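/- **Setting.** Let $\mathcal V=\{1,\dots,N\}$ be the nodes of a connected undirected graph with link set $\mathcal E\subset\mathcal V\times\mathcal V$ (links $(i,i)$ allowed), and $\mathcal N_i=\{j:(i,j)\in\mathcal E\}\cup\{i\}$. Let $A=[a_{ij}]$ be a symmetric, doubly stochastic, irreducible, aperiodic matrix with nonnegative entries such that $a_{ij}>0$ if and only if $(i,j)\in\mathcal E$. Let $\mathcal X\subset\mathbb R^d$ be closed and convex with Euclidean projection $\mathcal P_{\mathcal X}$, let each $f_i:\mathcal X\to\mathbb R$ be $L_i$-Lipschitz, and let $f=\frac1N\sum_{i=1}^N f_i$ be convex on $\mathcal X$, with a minimizer $\mathbf x^*\in\mathcal X$. **Algorithm.** Fix $b\in\mathbb N$ and $\Delta=2^{-b}$. A random $b$-bit quantization $q$ of $x\in[\tau,\tau+\Delta)$, $\tau\in\Delta\mathbb Z$, satisfies $\mathrm P(q=\tau+\Delta)=2^b(x-\tau)$ and $\mathrm P(q=\tau)=2^b(\tau+\Delta-x)$. Starting from square-integrable $\mathbf x_{i,0}\in\mathcal X$, the agents compute, for $k\ge 0$, $$\mathbf x_{i,k+1}=\mathcal P_{\mathcal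 X}\Big[(1-\beta_k)\mathbf x_{i,k}+\beta_k\sum_{j\in\mathcal N_i}a_{ij}\mathbf q_{j,k}-\alpha_k\mathbf g_{i,k}\Big],$$ where, conditionally on the history up to the computation of the $\mathbf x_{i,k}$ and $\mathbf g_{i,k}$, each coordinate of $\mathbf q_{j,k}$ is a random $b$-bit quantization of the same coordinate of $\mathbf x_{j,k}$, and $\mathbf g_{i,k}$ is a subgradient of $f_i$ at $\mathbf x_{i,k}$, that is, $f_i(\mathbf y)\ge f_i(\mathbf x_{i,k})+\langle\mathbf g_{i,k},\mathbf y-\mathbf x_{i,k}\rangle$ for all $\mathbf y\in\mathcal X$. The subgradients used are uniformly bounded: $\|\mathbf g_{i,k}\|\le G$ for all $i,k$ and some constant $G$. **Stepsizes.** Let $\alpha_k,\beta_k>0$ be decreasing (not necessarily strictly) with $$\lim_{k\to\infty}k\beta_k=\infty,\quad \lim_{k\to\infty}\frac1{k\alpha_k}\le C,\quad \sum_{k=0}^\infty\beta_k^2<\infty,\quad \sum_{k=0}^\infty\frac{\alpha_k^2}{\beta_k}<\infty,\quad \sum_{k=0}^\infty\alpha_k=\infty,\quad \sum_{k=0}^\infty\beta_k=\infty$$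 for some constant $C>0$. **Weights.** Let $\gamma_k^t>0$ ($0\le t\le k$) satisfy $\sum_{t=0}^k\gamma_k^t=1$ for all $k$, and $$\lim_{k\to\infty}\sum_{t=0}^k\frac{\gamma_k^t}{\alpha_t}\beta_t^2=0,\qquad \lim_{k\to\infty}\sum_{t=0}^k\frac{\gamma_k^t\alpha_t}{\beta_t}=0,$$ $$\frac{\gamma_k^{j+1}}{\alpha_{j+1}}\le\frac{\gamma_k^j}{\alpha_j}\quad(0\le j<k),\qquad \lim_{k\to\infty}\Big(\frac{\gamma_k^0}{\alpha_0}-\frac{\gamma_k^k}{\alpha_k}\Big)=0.$$ **Conclusion.** Let $\mathbf z_{i,k}=\sum_{t=0}^k\gamma_k^t\mathbf x_{i,t}$. Almost surely there is a minimizer $\mathbf y$ of $f$ over $\mathcal X$ (possibly depending on the realization) such that $\lim_{k\to\infty}\mathbf z_{i,k}=\mathbf y$ for all $i\in\mathcal V$. In particular, if $\mathbf x^*$ is the only minimizer of $f$ over $\mathcal X$, then almost surely $\lim_{k\to\infty}\mathbf z_{i,k}=\mathbf x^*$ for all $i\in\mathcal V$. -/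

import Mathlib

open MeasureTheory Filter Topology

noncomputable section

namespace GDSRQ

/-- The averaged objective `f = (1/N) ∑ i, f_i` of the `N` agents indexed by `V`. -/
def objective {V E : Type*} [Fintype V] (f : V → E → ℝ) (x : E) : ℝ :=
  (1 / (Fintype.card V : ℝ)) * ∑ i, f i x

/-- `g` is a subgradient at `x` of a function `f` defined on `X`. -/
def IsSubgradient {d : ℕ} (X : Set (EuclideanSpace ℝ (Fin d)))
    (f : EuclideanSpace ℝ (Fin d) → ℝ) (x g : EuclideanSpace ℝ (Fin d)) : Prop :=
  ∀ y ∈ X, f x + inner ℝ g (y - x) ≤ f y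

/-- `p` is the Euclidean projection of `v` onto `X`: a point of `X` nearest to `v`
(it exists and is unique when `X` is nonempty, closed and convex). -/
def IsProjection {d : ℕ} (X : Set (EuclideanSpace ℝ (Fin d)))
    (v p : EuclideanSpace ℝ (Fin d)) : Prop :=
  p ∈ X ∧ ∀ y ∈ X, ‖v - p‖ ≤ ‖v - y‖

/-- A nonnegative square matrix is aperiodic: for every index `i`, the lengths of the closed walks
through `i` along positive entries have no common divisor except `1`. -/
def IsAperiodic {V : Type*} [Fintype V] [DecidableEq V] (A : Matrix V V ℝ) : Prop :=
  ∀ i : V, ∀ p : ℕ, (∀ n : ℕ, 0 < n → 0 < (A ^ n) i i → p ∣ n) → p = 1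

/-- `A` is an admissible weight matrix for the connected undirected graph on `V` whose set of links
is `{(i, j) | link i j}` (a link from a node to itself is allowed). -/
structure IsWeightMatrix {V : Type*} [Fintype V] [DecidableEq V]
    (link : V → V → Prop) (A : Matrix V V ℝ) : Prop where
  link_symm : ∀ i j, link i j → link j i
  connected : (SimpleGraph.fromRel link).Connected
  symm : A.IsSymm
  stochastic : A ∈ doublyStochastic ℝ V
  irreducible : A.IsIrreducible
  aperiodic : IsAperiodic A
  pos_iff : ∀ i j, 0 < A i j ↔ link i j

/-- The neighbors of agent `i`, including `i` itself. -/
def neighbors {V : Type*} [Fintype V] (link : V → V → Prop) (i : V) : Finset V :=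
  open Classical in Finset.univ.filter fun j => link i j ∨ j = i

/-- Lower end of the cell of the grid `2⁻ᵇ ℤ` that contains `x`. -/
def quantLower (b : ℕ) (x : ℝ) : ℝ := (⌊(2 : ℝ) ^ b * x⌋ : ℝ) / 2 ^ b

/-- Upper end of the cell of the grid `2⁻ᵇ ℤ` that contains `x`. -/
def quantUpper (b : ℕ) (x : ℝ) : ℝ := quantLower b x + 1 / 2 ^ b

/-- Conditionally on the sub-σ-algebra `m`, the real random variable `q` is the random `b`-bit
quantization of the random variable `x`. -/
def IsRandomQuantization {Ω : Type*} [MeasurableSpace Ω] (μ : Measure Ω) (m : MeasurableSpace Ω)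
    (b : ℕ) (x q : Ω → ℝ) : Prop :=
  (μ[Set.indicator {ω | q ω = quantUpper b (x ω)} (fun _ => (1 : ℝ)) | m]
      =ᵐ[μ] fun ω => 2 ^ b * (x ω - quantLower b (x ω))) ∧
  (μ[Set.indicator {ω | q ω = quantLower b (x ω)} (fun _ => (1 : ℝ)) | m]
      =ᵐ[μ] fun ω => 2 ^ b * (quantUpper b (x ω) - x ω))

/-- The random sequences `x` (iterates), `q` (quantized iterates) and `g` (subgradients) form a run
of the distributed projected subgradient method with random `b`-bit quantization and stepsizes
`α`, `β`. The σ-algebra `ℱ k` is the history up to the moment before the quantization at time `k`.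
The quantization is prescribed through its law, coordinate by coordinate; nothing is assumed on the
joint law of different coordinates or agents. -/
structure IsRun {V : Type*} [Fintype V] {d : ℕ} {Ω : Type*} [mΩ : MeasurableSpace Ω]
    (μ : Measure Ω) (ℱ : Filtration ℕ mΩ) (X : Set (EuclideanSpace ℝ (Fin d)))
    (f : V → EuclideanSpace ℝ (Fin d) → ℝ) (link : V → V → Prop) (A : Matrix V V ℝ)
    (b : ℕ) (α β : ℕ → ℝ) (x q g : V → ℕ → Ω → EuclideanSpace ℝ (Fin d)) : Prop where
  measurable_x : ∀ i k, StronglyMeasurable[ℱ k] (x i k)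
  measurable_g : ∀ i k, StronglyMeasurable[ℱ k] (g i k)
  measurable_q : ∀ i k, StronglyMeasurable[ℱ (k + 1)] (q i k)
  init_mem : ∀ i ω, x i 0 ω ∈ X
  init_memLp : ∀ i, MemLp (x i 0) 2 μ
  quantized : ∀ i k (c : Fin d),
    IsRandomQuantization μ (ℱ k) b (fun ω => x i k ω c) (fun ω => q i k ω c)
  subgradient : ∀ i k ω, IsSubgradient X (f i) (x i k ω) (g i k ω)
  step : ∀ i k ω, IsProjection X
    (((1 - β k) • x i k ω + β k • ∑ j ∈ neighbors link i, A i j • q j k ω) - α k • g i k ω)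
    (x i (k + 1) ω)

/-- The weighted time average `z_{i,k} = ∑_{t ≤ k} γ_k^t x_{i,t}` of the iterates of one agent. -/
def timeAverage {d : ℕ} {Ω : Type*} (γ : ℕ → ℕ → ℝ) (x : ℕ → Ω → EuclideanSpace ℝ (Fin d))
    (k : ℕ) (ω : Ω) : EuclideanSpace ℝ (Fin d) :=
  ∑ t ∈ Finset.range (k + 1), γ k t • x t ω

end GDSRQ

end

/-! The iterates themselves converge almost surely to one random minimizer, and the averages inherit
the limit. Writing `q` as `x` plus noise turns the update into the projection of a lazy averaging
step, minus a subgradient step, plus `β` times a bounded noise with zero conditional mean.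

Fix a minimizer `y`. Projection is nonexpansive, averaging lowers the summed squared distance to `y`
in proportion to `β` times the disagreement, and the subgradient step lowers it by `2α` times the
optimality gap. Cross terms are absorbed by Young's inequality at cost `α²/β`, so
`sum_sq_dist_step_le` gives an almost supermartingale with summable errors of order `α²/β + β²`. By
the Robbins–Siegmund argument `ae_tendsto_and_summable_of_le`, the distances converge and the sums
of `α` times the gap and of `β` times the disagreement are finite. The disagreement obeys a similar
recursion (`disagreement_step_le`), so it converges; since `∑ β = ∞`, its limit is zero.

Since `∑ α = ∞`, the gap is small infinitely often, so some cluster point is a minimizer, and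
Opial's argument (`exists_isMinOn_tendsto`) makes it the limit. The exceptional null set depends on
`y`, so the argument runs over a countable dense set of minimizers. Finally, the weights forget
every fixed time (`tendsto_weight_zero`), and a Toeplitz argument passes to the averages. -/

namespace GDSRQ

/-! ### Lazy averaging and disagreement on a connected network. -/

section Consensus

variable {V E : Type*} [Fintype V] [NormedAddCommGroup E]

/-- The disagreement of the states `x` along the links, weighted by the entries of `A`. -/
def linkDisagreement (A : Matrix V V ℝ) (x : V → E) : ℝ :=
  ∑ i, ∑ j, A i j * ‖x i - x j‖ ^ 2

/-- The total disagreement of the states `x`. -/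
def disagreement (x : V → E) : ℝ :=
  ∑ i, ∑ j, ‖x i - x j‖ ^ 2

lemma disagreement_nonneg (x : V → E) : 0 ≤ disagreement x :=
  Finset.sum_nonneg fun _ _ => Finset.sum_nonneg fun _ _ => by positivity

lemma sq_norm_sub_le_disagreement (x : V → E) (i j : V) :
    ‖x i - x j‖ ^ 2 ≤ disagreement x :=
  (Finset.single_le_sum (f := fun j => ‖x i - x j‖ ^ 2) (fun _ _ => by positivity)
    (Finset.mem_univ j)).trans
  (Finset.single_le_sum (f := fun i => ∑ j, ‖x i - x j‖ ^ 2)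
    (fun _ _ => Finset.sum_nonneg fun _ _ => by positivity) (Finset.mem_univ i))

lemma sum_sq_norm_sub_le_disagreement (x : V → E) (j : V) :
    ∑ i, ‖x i - x j‖ ^ 2 ≤ disagreement x :=
  Finset.sum_le_sum fun _ _ =>
    Finset.single_le_sum (f := fun j => ‖x _ - x j‖ ^ 2) (fun _ _ => by positivity)
      (Finset.mem_univ j)

lemma linkDisagreement_nonneg [DecidableEq V] {A : Matrix V V ℝ} (hA : A ∈ doublyStochastic ℝ V) (x : V → E) :
    0 ≤ linkDisagreement A x :=
  Finset.sum_nonneg fun _ _ => Finset.sum_nonneg fun _ _ =>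
    mul_nonneg (nonneg_of_mem_doublyStochastic hA) (by positivity)

/-- In a connected network the disagreement along the links controls the total disagreement. -/
lemma exists_disagreement_le [DecidableEq V] {A : Matrix V V ℝ} {link : V → V → Prop}
    (hA : IsWeightMatrix link A) :
    ∃ K : ℝ, 0 < K ∧ ∀ x : V → E, disagreement x ≤ K * linkDisagreement A x := by
  -- Induction along a walk from `i` to `j`, with `(s + t)² ≤ 2s² + 2t²` at each link.
  have hpair : ∀ i j, ∃ K : ℝ, 0 ≤ K ∧ ∀ x : V → E,
      ‖x i - x j‖ ^ 2 ≤ K * linkDisagreement A x := by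
    intro i j
    obtain ⟨w⟩ := hA.connected.preconnected i j
    induction w with
    | nil => exact ⟨0, le_rfl, fun x => by simp⟩
    | @cons u v w huv _ ih =>
      obtain ⟨K, hK, ih⟩ := ih
      have hl : link u v := by
        rcases (SimpleGraph.fromRel_adj _ _ _).1 huv with ⟨_, h | h⟩
        exacts [h, hA.link_symm _ _ h]
      have ha : 0 < A u v := (hA.pos_iff u v).2 hl
      refine ⟨2 / A u v + 2 * K, by positivity, fun x => ?_⟩
      have hD : A u v * ‖x u - x v‖ ^ 2 ≤ linkDisagreement A x :=
        (Finset.single_le_sum (f := fun j => A u j * ‖x u - x j‖ ^ 2)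
          (fun _ _ => mul_nonneg (nonneg_of_mem_doublyStochastic hA.stochastic) (by positivity))
          (Finset.mem_univ v)).trans
        (Finset.single_le_sum (f := fun i => ∑ j, A i j * ‖x i - x j‖ ^ 2)
          (fun _ _ => Finset.sum_nonneg fun _ _ =>
            mul_nonneg (nonneg_of_mem_doublyStochastic hA.stochastic) (by positivity))
          (Finset.mem_univ u))
      have hD' : ‖x u - x v‖ ^ 2 ≤ 1 / A u v * linkDisagreement A x := by
        rw [one_div, ← div_eq_inv_mul, le_div_iff₀ ha]
        linarith
      have htri : ‖x u - x w‖ ^ 2 ≤ 2 * ‖x u - x v‖ ^ 2 + 2 * ‖x v - x w‖ ^ 2 := by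
        have := norm_sub_le_norm_sub_add_norm_sub (x u) (x v) (x w)
        nlinarith [norm_nonneg (x u - x w), sq_nonneg (‖x u - x v‖ - ‖x v - x w‖)]
      have := ih x
      have e : (2 / A u v + 2 * K) * linkDisagreement A x =
        2 * (1 / A u v * linkDisagreement A x) + 2 * (K * linkDisagreement A x) := by ring
      linarith
  choose K hK hKx using hpair
  -- The `+ 1` keeps the constant positive even if all pair constants vanish, as for a single node.
  refine ⟨∑ i, ∑ j, K i j + 1, ?_, fun x => ?_⟩
  · have : 0 ≤ ∑ i, ∑ j, K i j :=
      Finset.sum_nonneg fun _ _ => Finset.sum_nonneg fun _ _ => hK _ _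
    linarith
  · have h : disagreement x ≤ (∑ i, ∑ j, K i j) * linkDisagreement A x := by
      simp only [Finset.sum_mul]
      exact Finset.sum_le_sum fun i _ => Finset.sum_le_sum fun j _ => hKx i j x
    linarith [linkDisagreement_nonneg hA.stochastic x]

variable [InnerProductSpace ℝ E]

/-- One lazy averaging step with weight matrix `A` and stepsize `β`. -/
def mix (A : Matrix V V ℝ) (β : ℝ) (x : V → E) (i : V) : E :=
  (1 - β) • x i + β • ∑ j, A i j • x j

lemma sq_norm_sum_smul_le {a : V → ℝ} (ha : ∀ j, 0 ≤ a j) (ha1 : ∑ j, a j = 1) (z : V → E) :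
    ‖∑ j, a j • z j‖ ^ 2 ≤ ∑ j, a j * ‖z j‖ ^ 2 := by
  have hconv : ConvexOn ℝ Set.univ fun v : E => ‖v‖ ^ 2 :=
    (convexOn_norm convex_univ).pow (fun _ _ => norm_nonneg _) 2
  simpa using hconv.map_sum_le (t := Finset.univ) (w := a) (p := z) (fun j _ => ha j) ha1
    (fun _ _ => Set.mem_univ _)

/-- Symmetry of `A` allows swapping `i` and `j`; adding the two versions cancels `y` and leaves `‖x
i - x j‖²`. -/
lemma two_mul_sum_inner_displacement {A : Matrix V V ℝ} (hs : A.IsSymm) (x : V → E) (y : E) :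
    2 * ∑ i, inner ℝ (x i - y) (∑ j, A i j • (x i - x j)) = linkDisagreement A x := by
  have h1 : ∑ i, inner ℝ (x i - y) (∑ j, A i j • (x i - x j)) =
      ∑ i, ∑ j, A i j * inner ℝ (x i - y) (x i - x j) := by
    simp only [inner_sum, inner_smul_right]
  have h2 : ∑ i, ∑ j, A i j * inner ℝ (x i - y) (x i - x j) =
      ∑ i, ∑ j, A i j * inner ℝ (x j - y) (x j - x i) := by
    rw [Finset.sum_comm]
    exact Finset.sum_congr rfl fun i _ => Finset.sum_congr rfl fun j _ => by rw [hs.apply]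
  rw [two_mul, h1]
  nth_rw 2 [h2]
  simp only [linkDisagreement, ← Finset.sum_add_distrib, ← mul_add]
  refine Finset.sum_congr rfl fun i _ => Finset.sum_congr rfl fun j _ => ?_
  congr 1
  have e : x j - x i = -(x i - x j) := by abel
  rw [e, inner_neg_right, ← sub_eq_add_neg, ← inner_sub_left, ← real_inner_self_eq_norm_sq]
  congr 1
  abel

lemma disagreement_eq (x : V → E) :
    disagreement x = 2 * Fintype.card V * ∑ i, ‖x i‖ ^ 2 - 2 * ‖∑ i, x i‖ ^ 2 := by
  have h : ∑ i, ∑ j, inner ℝ (x i) (x j) = ‖∑ i, x i‖ ^ 2 := by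
    rw [← real_inner_self_eq_norm_sq, sum_inner]
    simp only [inner_sum]
  simp only [disagreement, norm_sub_sq_real, Finset.sum_add_distrib, Finset.sum_sub_distrib,
    ← Finset.mul_sum, h, Finset.sum_const, Finset.card_univ, nsmul_eq_mul]
  ring

variable {A : Matrix V V ℝ} [DecidableEq V]

/-- The displacement of an agent towards the weighted mean of its neighbors. -/
lemma mix_eq_sub (hA : A ∈ doublyStochastic ℝ V) (β : ℝ) (x : V → E) (i : V) :
    mix A β x i = x i - β • ∑ j, A i j • (x i - x j) := by
  have h : ∑ j, A i j • (x i - x j) = x i - ∑ j, A i j • x j := by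
    simp only [smul_sub, Finset.sum_sub_distrib, ← Finset.sum_smul,
      sum_row_of_mem_doublyStochastic hA, one_smul]
  rw [h, mix, smul_sub, sub_smul, one_smul]
  abel

lemma sum_sq_norm_displacement_le (hA : A ∈ doublyStochastic ℝ V) (x : V → E) :
    ∑ i, ‖∑ j, A i j • (x i - x j)‖ ^ 2 ≤ linkDisagreement A x :=
  Finset.sum_le_sum fun i _ =>
    sq_norm_sum_smul_le (fun _ => nonneg_of_mem_doublyStochastic hA)
      (sum_row_of_mem_doublyStochastic hA i) _

/-- Averaging decreases the squared distance to any point by a multiple of the disagreement. -/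
lemma sum_sq_norm_mix_sub_le (hA : A ∈ doublyStochastic ℝ V) (hs : A.IsSymm) {β : ℝ}
    (h0 : 0 ≤ β) (h1 : β ≤ 1 / 2) (x : V → E) (y : E) :
    ∑ i, ‖mix A β x i - y‖ ^ 2 + β / 2 * linkDisagreement A x ≤ ∑ i, ‖x i - y‖ ^ 2 := by
  have key : ∀ i, ‖mix A β x i - y‖ ^ 2 = ‖x i - y‖ ^ 2
      - 2 * β * inner ℝ (x i - y) (∑ j, A i j • (x i - x j))
      + β ^ 2 * ‖∑ j, A i j • (x i - x j)‖ ^ 2 := fun i => by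
    rw [mix_eq_sub hA, sub_right_comm, norm_sub_sq_real, inner_smul_right, norm_smul, mul_pow,
      Real.norm_eq_abs, sq_abs]
    ring
  simp only [key, Finset.sum_add_distrib, Finset.sum_sub_distrib, ← Finset.mul_sum]
  have e1 := two_mul_sum_inner_displacement hs x y
  have e2 := sum_sq_norm_displacement_le hA x
  have e3 := linkDisagreement_nonneg hA x
  -- The first-order gain is `β` times the link disagreement; `β ≤ 1/2` lets the second-order term
  -- consume at most half of it.
  have e4 : β ^ 2 * ∑ i, ‖∑ j, A i j • (x i - x j)‖ ^ 2 ≤ β / 2 * linkDisagreement A x :=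
    mul_le_mul (by nlinarith) e2 (Finset.sum_nonneg fun _ _ => by positivity) (by positivity)
  have e5 : 2 * β * ∑ i, inner ℝ (x i - y) (∑ j, A i j • (x i - x j)) =
      β * linkDisagreement A x := by rw [← e1]; ring
  linarith

lemma sum_mix (hA : A ∈ doublyStochastic ℝ V) (β : ℝ) (x : V → E) :
    ∑ i, mix A β x i = ∑ i, x i := by
  have h : ∑ i, ∑ j, A i j • x j = ∑ i, x i := by
    rw [Finset.sum_comm]
    simp only [← Finset.sum_smul, sum_col_of_mem_doublyStochastic hA, one_smul]
  simp only [mix, Finset.sum_add_distrib, ← Finset.smul_sum, h, ← add_smul, sub_add_cancel,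
    one_smul]

/-- Averaging preserves the sum of the states, so by `disagreement_eq` the drop is `2N` times the
drop of the sum of squares, with `N` the number of agents. -/
lemma disagreement_mix_le (hA : A ∈ doublyStochastic ℝ V) (hs : A.IsSymm) {β : ℝ}
    (h0 : 0 ≤ β) (h1 : β ≤ 1 / 2) (x : V → E) :
    disagreement (mix A β x) + Fintype.card V * β * linkDisagreement A x ≤ disagreement x := by
  have h := sum_sq_norm_mix_sub_le hA hs h0 h1 x 0
  simp only [sub_zero] at h
  rw [disagreement_eq, disagreement_eq, sum_mix hA]
  nlinarith [(Nat.cast_nonneg (Fintype.card V) : (0 : ℝ) ≤ _)]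

end Consensus

/-! ### Projections onto a convex set. -/

section Projection

variable {d : ℕ} {X : Set (EuclideanSpace ℝ (Fin d))}

lemma IsProjection.inner_le_zero (hX : Convex ℝ X) {v p y : EuclideanSpace ℝ (Fin d)}
    (h : IsProjection X v p) (hy : y ∈ X) : inner ℝ (v - p) (y - p) ≤ 0 := by
  refine (norm_eq_iInf_iff_real_inner_le_zero hX h.1).1 ?_ y hy
  have : Nonempty X := ⟨⟨p, h.1⟩⟩
  refine le_antisymm (le_ciInf fun w => h.2 w w.2) ?_
  exact ciInf_le (f := fun w : X => ‖v - w‖) ⟨0, by rintro _ ⟨w, rfl⟩; positivity⟩ ⟨p, h.1⟩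

/-- Adding the variational inequalities of the two projections bounds `‖p - p'‖²` by `⟪v - v', p -
p'⟫`; Cauchy–Schwarz finishes. -/
lemma IsProjection.norm_sub_le (hX : Convex ℝ X) {v p v' p' : EuclideanSpace ℝ (Fin d)}
    (h : IsProjection X v p) (h' : IsProjection X v' p') : ‖p - p'‖ ≤ ‖v - v'‖ := by
  have h1 := h.inner_le_zero hX h'.1
  have h2 := h'.inner_le_zero hX h.1
  have e1 : inner ℝ (v - p) (p' - p) = - inner ℝ (v - p) (p - p') := by
    rw [← inner_neg_right, neg_sub]
  have e2 : inner ℝ (p - p') (p - p') ≤ inner ℝ (v - v') (p - p') := by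
    simp only [inner_sub_left] at *
    linarith
  rw [real_inner_self_eq_norm_sq] at e2
  have e3 := real_inner_le_norm (v - v') (p - p')
  by_contra! hlt
  nlinarith [norm_nonneg (v - v'), norm_nonneg (p - p')]

lemma isProjection_self {y : EuclideanSpace ℝ (Fin d)} (hy : y ∈ X) : IsProjection X y y :=
  ⟨hy, fun _ _ => by simp⟩

end Projection

/-! ### Deterministic one-step inequalities. -/

section Step

variable {V : Type*} [Fintype V] [DecidableEq V] {d : ℕ} {X : Set (EuclideanSpace ℝ (Fin d))}
  {link : V → V → Prop} {A : Matrix V V ℝ} {α β G K : ℝ}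
  {x g ε x' : V → EuclideanSpace ℝ (Fin d)}

lemma two_mul_mul_le_div_add_mul {η : ℝ} (hη : 0 < η) (a b : ℝ) :
    2 * a * b ≤ a ^ 2 / η + η * b ^ 2 := by
  have h : 0 ≤ (a - η * b) ^ 2 / η := by positivity
  have e : (a - η * b) ^ 2 / η = a ^ 2 / η + η * b ^ 2 - 2 * a * b := by
    field_simp
    ring
  linarith

/-- One step of the method decreases the squared distance to a point of `X`, up to noise. -/
lemma sum_sq_dist_step_le (hX : Convex ℝ X) (hA : IsWeightMatrix link A) (hK : 0 < K)
    (hKx : ∀ x : V → EuclideanSpace ℝ (Fin d), disagreement x ≤ K * linkDisagreement A x)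
    {f : V → EuclideanSpace ℝ (Fin d) → ℝ} {L : V → NNReal}
    (hf : ∀ i, LipschitzOnWith (L i) (f i) X)
    (hα : 0 < α) (hβ : 0 < β) (hβ2 : β ≤ 1 / 2) (hx : ∀ i, x i ∈ X)
    (hg : ∀ i, IsSubgradient X (f i) (x i) (g i)) (hG : ∀ i, ‖g i‖ ≤ G)
    (hx' : ∀ i, IsProjection X (mix A β x i - α • g i + β • ε i) (x' i))
    {y : EuclideanSpace ℝ (Fin d)} (hy : y ∈ X) (i₀ : V) :
    ∑ i, ‖x' i - y‖ ^ 2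
        + (2 * α * ∑ i, (f i (x i₀) - f i y) + β / 4 * linkDisagreement A x) ≤
      ∑ i, ‖x i - y‖ ^ 2 + ((∑ i, (3 * G ^ 2 + 8 * K * (L i : ℝ) ^ 2)) * (α ^ 2 / β)
        + β ^ 2 * ∑ i, ‖ε i‖ ^ 2)
        + 2 * β * ∑ i, inner ℝ (mix A β x i - α • g i - y) (ε i) := by
  have hαβ : α ^ 2 ≤ 1 / 2 * (α ^ 2 / β) := by
    rw [← mul_div_assoc, le_div_iff₀ hβ]
    nlinarith [sq_nonneg α]
  have hβαβ : 8 * (α ^ 2 * β) ≤ 2 * (α ^ 2 / β) := by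
    rw [← mul_div_assoc, le_div_iff₀ hβ]
    have : β * β ≤ 1 / 4 := by nlinarith
    nlinarith [sq_nonneg α]
  -- Averaging supplies `β/2` times the link disagreement: `β/8` pays for the displacement term,
  -- `β/8` for moving from `x i` to `x i₀`, and `β/4` is kept.
  have key : ∀ i, ‖x' i - y‖ ^ 2 + 2 * α * (f i (x i₀) - f i y) ≤ ‖mix A β x i - y‖ ^ 2
      + β / 8 * ‖∑ j, A i j • (x i - x j)‖ ^ 2 + β / (8 * K) * ‖x i - x i₀‖ ^ 2
      + (3 * G ^ 2 + 8 * K * (L i : ℝ) ^ 2) * (α ^ 2 / β) + β ^ 2 * ‖ε i‖ ^ 2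
      + 2 * β * inner ℝ (mix A β x i - α • g i - y) (ε i) := by
    intro i
    have hG0 : ‖g i‖ ^ 2 ≤ G ^ 2 := pow_le_pow_left₀ (norm_nonneg _) (hG i) 2
    have h1 : ‖x' i - y‖ ^ 2 ≤ ‖mix A β x i - α • g i + β • ε i - y‖ ^ 2 :=
      pow_le_pow_left₀ (norm_nonneg _) ((hx' i).norm_sub_le hX (isProjection_self hy)) 2
    have h2 : ‖mix A β x i - α • g i + β • ε i - y‖ ^ 2 = ‖mix A β x i - α • g i - y‖ ^ 2
        + 2 * β * inner ℝ (mix A β x i - α • g i - y) (ε i) + β ^ 2 * ‖ε i‖ ^ 2 := by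
      rw [add_sub_right_comm, norm_add_sq_real, inner_smul_right, norm_smul, mul_pow,
        Real.norm_eq_abs, sq_abs]
      ring
    have h3 : ‖mix A β x i - α • g i - y‖ ^ 2 = ‖mix A β x i - y‖ ^ 2
        - 2 * α * inner ℝ (g i) (mix A β x i - y) + α ^ 2 * ‖g i‖ ^ 2 := by
      rw [sub_right_comm, norm_sub_sq_real, inner_smul_right, norm_smul, mul_pow,
        Real.norm_eq_abs, sq_abs, real_inner_comm]
      ring
    have h4 : inner ℝ (g i) (mix A β x i - y) = - inner ℝ (g i) (y - x i)
        - β * inner ℝ (g i) (∑ j, A i j • (x i - x j)) := by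
      rw [mix_eq_sub hA.stochastic, ← inner_smul_right, ← inner_neg_right, ← inner_sub_right]
      congr 1
      abel
    have h5 : f i (x i) + inner ℝ (g i) (y - x i) ≤ f i y := hg i y hy
    -- All `f i` must be evaluated at the common point `x i₀`: a minimizer of the average makes only
    -- the sum of the gaps at one point nonnegative.
    have h6 : f i (x i₀) - f i (x i) ≤ L i * ‖x i - x i₀‖ := by
      have := (hf i).dist_le_mul _ (hx i₀) _ (hx i)
      rw [Real.dist_eq, dist_eq_norm, norm_sub_rev] at this
      exact (le_abs_self _).trans this
    have h7 : 2 * (α * L i) * ‖x i - x i₀‖ ≤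
        8 * K * (L i : ℝ) ^ 2 * (α ^ 2 / β) + β / (8 * K) * ‖x i - x i₀‖ ^ 2 := by
      refine (two_mul_mul_le_div_add_mul (η := β / (8 * K)) (by positivity) _ _).trans_eq ?_
      congr 1
      field_simp
    have h8 : 2 * (α * β * ‖g i‖) * ‖∑ j, A i j • (x i - x j)‖ ≤
        8 * (α ^ 2 * β) * ‖g i‖ ^ 2 + β / 8 * ‖∑ j, A i j • (x i - x j)‖ ^ 2 := by
      refine (two_mul_mul_le_div_add_mul (η := β / 8) (by positivity) _ _).trans_eq ?_
      congr 1
      field_simp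
    have h9 := real_inner_le_norm (g i) (∑ j, A i j • (x i - x j))
    have h10 : 2 * α * β * inner ℝ (g i) (∑ j, A i j • (x i - x j)) ≤
        2 * (α * β * ‖g i‖) * ‖∑ j, A i j • (x i - x j)‖ := by
      calc _ ≤ 2 * α * β * (‖g i‖ * ‖∑ j, A i j • (x i - x j)‖) :=
            mul_le_mul_of_nonneg_left h9 (by positivity)
        _ = _ := by ring
    have h11 : 8 * (α ^ 2 * β) * ‖g i‖ ^ 2 ≤ 2 * (α ^ 2 / β) * G ^ 2 :=
      mul_le_mul hβαβ hG0 (by positivity) (by positivity)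
    have h12 : α ^ 2 * ‖g i‖ ^ 2 ≤ 1 / 2 * (α ^ 2 / β) * G ^ 2 :=
      mul_le_mul hαβ hG0 (by positivity) (by positivity)
    have h13 : 0 ≤ α ^ 2 / β * G ^ 2 := by positivity
    have h14 : 2 * α * (f i (x i₀) - f i y + inner ℝ (g i) (y - x i)) ≤
        2 * α * (L i * ‖x i - x i₀‖) := mul_le_mul_of_nonneg_left (by linarith) (by positivity)
    rw [h2, h3, h4] at h1
    linarith
  have hsum := Finset.sum_le_sum fun i (_ : i ∈ Finset.univ) => key i
  simp only [Finset.sum_add_distrib, ← Finset.mul_sum, ← Finset.sum_mul] at hsum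
  have c1 := sum_sq_norm_mix_sub_le hA.stochastic hA.symm hβ.le hβ2 x y
  have c2 : β / 8 * ∑ i, ‖∑ j, A i j • (x i - x j)‖ ^ 2 ≤ β / 8 * linkDisagreement A x :=
    mul_le_mul_of_nonneg_left (sum_sq_norm_displacement_le hA.stochastic x) (by positivity)
  have c3 : β / (8 * K) * ∑ i, ‖x i - x i₀‖ ^ 2 ≤ β / 8 * linkDisagreement A x := by
    calc _ ≤ β / (8 * K) * (K * linkDisagreement A x) :=
          mul_le_mul_of_nonneg_left ((sum_sq_norm_sub_le_disagreement x i₀).trans (hKx x))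
            (by positivity)
      _ = _ := by field_simp
  simp only [Finset.sum_add_distrib, ← Finset.mul_sum]
  linarith

/-- One step of the method does not increase the disagreement, up to noise. -/
lemma disagreement_step_le [Nonempty V] (hX : Convex ℝ X) (hA : IsWeightMatrix link A)
    (hK : 0 < K)
    (hKx : ∀ x : V → EuclideanSpace ℝ (Fin d), disagreement x ≤ K * linkDisagreement A x)
    (hα : 0 < α) (hβ : 0 < β) (hβ2 : β ≤ 1 / 2) (hG : ∀ i, ‖g i‖ ≤ G)
    (hx' : ∀ i, IsProjection X (mix A β x i - α • g i + β • ε i) (x' i)) :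
    disagreement x' ≤ disagreement x
        + (Fintype.card V ^ 2 * (4 * G ^ 2 * K / Fintype.card V + 2 * G ^ 2) * (α ^ 2 / β)
        + β ^ 2 * disagreement ε)
        + 2 * β * ∑ i, ∑ j,
          inner ℝ ((mix A β x i - α • g i) - (mix A β x j - α • g j)) (ε i - ε j) := by
  have hN : (0 : ℝ) < Fintype.card V := by exact_mod_cast Fintype.card_pos
  have hαβ : 4 * α ^ 2 ≤ 2 * (α ^ 2 / β) := by
    rw [← mul_div_assoc, le_div_iff₀ hβ]
    nlinarith [sq_nonneg α]
  have key : ∀ i j, ‖x' i - x' j‖ ^ 2 ≤ ‖mix A β x i - mix A β x j‖ ^ 2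
      + Fintype.card V * β / K * ‖mix A β x i - mix A β x j‖ ^ 2
      + (4 * G ^ 2 * K / Fintype.card V + 2 * G ^ 2) * (α ^ 2 / β) + β ^ 2 * ‖ε i - ε j‖ ^ 2
      + 2 * β * inner ℝ ((mix A β x i - α • g i) - (mix A β x j - α • g j)) (ε i - ε j) := by
    intro i j
    have hG0 : 0 ≤ G := (norm_nonneg _).trans (hG i)
    have h1 : ‖x' i - x' j‖ ^ 2 ≤ ‖(mix A β x i - α • g i + β • ε i)
        - (mix A β x j - α • g j + β • ε j)‖ ^ 2 :=
      pow_le_pow_left₀ (norm_nonneg _) ((hx' i).norm_sub_le hX (hx' j)) 2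
    have h2 : ‖(mix A β x i - α • g i + β • ε i) - (mix A β x j - α • g j + β • ε j)‖ ^ 2 =
        ‖(mix A β x i - α • g i) - (mix A β x j - α • g j)‖ ^ 2
        + 2 * β * inner ℝ ((mix A β x i - α • g i) - (mix A β x j - α • g j)) (ε i - ε j)
        + β ^ 2 * ‖ε i - ε j‖ ^ 2 := by
      rw [add_sub_add_comm, ← smul_sub, norm_add_sq_real, inner_smul_right, norm_smul, mul_pow,
        Real.norm_eq_abs, sq_abs]
      ring
    have h3 : ‖(mix A β x i - α • g i) - (mix A β x j - α • g j)‖ ≤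
        ‖mix A β x i - mix A β x j‖ + 2 * (α * G) := by
      rw [sub_sub_sub_comm, ← smul_sub]
      refine (norm_sub_le _ _).trans (add_le_add_right ?_ _)
      rw [norm_smul, Real.norm_eq_abs, abs_of_pos hα]
      have : ‖g i - g j‖ ≤ 2 * G := (norm_sub_le _ _).trans (by linarith [hG i, hG j])
      nlinarith
    have h4 := pow_le_pow_left₀ (norm_nonneg _) h3 2
    -- The Young weight `N * β / K`, with `N` the number of agents, is chosen so that the last term,
    -- summed over all pairs, is exactly what the averaging gain can pay for (`c2`).
    have h5 : 2 * (2 * (α * G)) * ‖mix A β x i - mix A β x j‖ ≤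
        4 * G ^ 2 * K / Fintype.card V * (α ^ 2 / β)
        + Fintype.card V * β / K * ‖mix A β x i - mix A β x j‖ ^ 2 := by
      refine (two_mul_mul_le_div_add_mul (η := Fintype.card V * β / K)
        (by positivity) _ _).trans_eq ?_
      congr 1
      field_simp
      ring
    have h6 : 4 * α ^ 2 * G ^ 2 ≤ 2 * (α ^ 2 / β) * G ^ 2 :=
      mul_le_mul_of_nonneg_right hαβ (by positivity)
    rw [h2] at h1
    linarith
  have hsum := Finset.sum_le_sum fun i (_ : i ∈ Finset.univ) =>
    Finset.sum_le_sum fun j (_ : j ∈ Finset.univ) => key i j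
  have c1 := disagreement_mix_le hA.stochastic hA.symm hβ.le hβ2 x
  have c2 : Fintype.card V * β / K * disagreement (mix A β x) ≤
      Fintype.card V * β * linkDisagreement A x := by
    have hle : disagreement (mix A β x) ≤ K * linkDisagreement A x := by
      have := mul_nonneg (by positivity : 0 ≤ Fintype.card V * β)
        (linkDisagreement_nonneg hA.stochastic x)
      linarith [hKx x]
    calc _ ≤ Fintype.card V * β / K * (K * linkDisagreement A x) :=
          mul_le_mul_of_nonneg_left hle (by positivity)
      _ = _ := by field_simp
  simp only [Finset.sum_add_distrib, ← Finset.mul_sum, Finset.sum_const, Finset.card_univ,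
    nsmul_eq_mul] at hsum
  simp only [disagreement] at *
  linarith

end Step

/-! ### Almost supermartingales. -/

section Probability

variable {Ω : Type*} {m : MeasurableSpace Ω} [mΩ : MeasurableSpace Ω] {μ : Measure Ω} [IsProbabilityMeasure μ]

/-- A mean-zero martingale `M ≥ -b` satisfies `|M| ≤ M + 2|b|`, hence is bounded in `L¹`, and Doob's
convergence theorem applies. -/
lemma ae_tendsto_sum_of_condExp_eq_zero (ℱ : Filtration ℕ mΩ) {ξ : ℕ → Ω → ℝ}
    (hmeas : ∀ k, StronglyMeasurable[ℱ (k + 1)] (ξ k)) (hint : ∀ k, Integrable (ξ k) μ)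
    (hzero : ∀ k, μ[ξ k | ℱ k] =ᵐ[μ] 0) {b : Ω → ℝ} (hb : Integrable b μ)
    (hbdd : ∀ n, ∀ᵐ ω ∂μ, -b ω ≤ ∑ k ∈ Finset.range n, ξ k ω) :
    ∀ᵐ ω ∂μ, ∃ c, Tendsto (fun n => ∑ k ∈ Finset.range n, ξ k ω) atTop (𝓝 c) := by
  have hadp : StronglyAdapted ℱ fun n ω => ∑ k ∈ Finset.range n, ξ k ω := fun n =>
    Finset.stronglyMeasurable_fun_sum _ fun k hk =>
      (hmeas k).mono (ℱ.mono (Finset.mem_range.1 hk))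
  have hI : ∀ n, Integrable (fun ω => ∑ k ∈ Finset.range n, ξ k ω) μ := fun n =>
    integrable_finsetSum _ fun k _ => hint k
  have hM : Martingale (fun n ω => ∑ k ∈ Finset.range n, ξ k ω) ℱ μ := by
    refine martingale_of_condExp_sub_eq_zero_nat hadp hI fun n => ?_
    have e : (fun ω => ∑ k ∈ Finset.range (n + 1), ξ k ω)
        - (fun ω => ∑ k ∈ Finset.range n, ξ k ω) = ξ n := by
      ext ω
      simp [Finset.sum_range_succ]
    rw [e]
    exact hzero n
  have hmean : ∀ n, ∫ ω, ∑ k ∈ Finset.range n, ξ k ω ∂μ = 0 := fun n => by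
    rw [integral_finsetSum _ fun k _ => hint k]
    refine Finset.sum_eq_zero fun k _ => ?_
    rw [← integral_condExp (ℱ.le k), integral_congr_ae (hzero k)]
    simp
  refine hM.submartingale.exists_ae_tendsto_of_bdd
    (R := (∫ ω, 2 * |b ω| ∂μ).toNNReal) fun n => ?_
  rw [eLpNorm_one_eq_lintegral_enorm, ← ofReal_integral_norm_eq_lintegral_enorm (hI n),
    ENNReal.ofReal]
  refine ENNReal.coe_le_coe.2 (Real.toNNReal_le_toNNReal ?_)
  have hle : ∫ ω, ‖∑ k ∈ Finset.range n, ξ k ω‖ ∂μ ≤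
      ∫ ω, (∑ k ∈ Finset.range n, ξ k ω) + 2 * |b ω| ∂μ := by
    refine integral_mono_ae (hI n).norm ((hI n).add (hb.abs.const_mul 2)) ?_
    filter_upwards [hbdd n] with ω hω
    rw [Real.norm_eq_abs]
    have := le_abs_self (b ω)
    rcases abs_cases (∑ k ∈ Finset.range n, ξ k ω) with ⟨h, _⟩ | ⟨h, _⟩ <;> rw [h] <;>
      linarith [abs_nonneg (b ω)]
  rw [integral_add (hI n) (hb.abs.const_mul 2), hmean, zero_add] at hle
  exact hle

/-- A Robbins–Siegmund type statement: an almost supermartingale converges, and the decrements are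
summable. -/
lemma ae_tendsto_and_summable_of_le (ℱ : Filtration ℕ mΩ) {W a ξ : ℕ → Ω → ℝ} {n : ℕ → ℝ}
    (hW : ∀ k ω, 0 ≤ W k ω) (ha : ∀ k ω, 0 ≤ a k ω) (hn0 : ∀ k, 0 ≤ n k) (hn : Summable n)
    (hW0 : Integrable (W 0) μ)
    (hmeas : ∀ k, StronglyMeasurable[ℱ (k + 1)] (ξ k)) (hint : ∀ k, Integrable (ξ k) μ)
    (hzero : ∀ k, μ[ξ k | ℱ k] =ᵐ[μ] 0)
    (hle : ∀ᵐ ω ∂μ, ∀ k, W (k + 1) ω + a k ω ≤ W k ω + n k + ξ k ω) :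
    ∀ᵐ ω ∂μ, (∃ c, Tendsto (fun k => W k ω) atTop (𝓝 c)) ∧ Summable fun k => a k ω := by
  have hsum : ∀ᵐ ω ∂μ, ∀ m, W m ω + ∑ k ∈ Finset.range m, a k ω ≤
      W 0 ω + ∑ k ∈ Finset.range m, n k + ∑ k ∈ Finset.range m, ξ k ω := by
    filter_upwards [hle] with ω hω m
    induction m with
    | zero => simp
    | succ m ih =>
      simp only [Finset.sum_range_succ]
      linarith [hω m]
  have hnle : ∀ m, ∑ k ∈ Finset.range m, n k ≤ ∑' k, n k := fun m =>
    hn.sum_le_tsum _ fun k _ => hn0 k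
  -- Since `W` and `a` are nonnegative, the summed inequality bounds the noise sums below by an
  -- integrable variable.
  have hM := ae_tendsto_sum_of_condExp_eq_zero ℱ hmeas hint hzero
    (b := fun ω => W 0 ω + ∑' k, n k) (hW0.add (integrable_const _)) fun m => by
      filter_upwards [hsum] with ω hω
      have h1 := hω m
      have h2 : 0 ≤ ∑ k ∈ Finset.range m, a k ω := Finset.sum_nonneg fun k _ => ha k ω
      linarith [hW m ω, hnle m]
  filter_upwards [hle, hsum, hM] with ω hω hs ⟨c, hc⟩
  have hN := hn.hasSum.tendsto_sum_nat
  obtain ⟨B, hB⟩ := hc.bddAbove_range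
  have hsa : Summable fun k => a k ω := by
    refine summable_of_sum_range_le (c := W 0 ω + ∑' k, n k + B) (fun k => ha k ω) fun m => ?_
    have := hB (Set.mem_range_self m)
    linarith [hs m, hW m ω, hnle m]
  refine ⟨?_, hsa⟩
  -- Compensating `W` by three convergent sums makes it monotone, hence convergent.
  have hanti : Antitone fun m => W m ω + ∑ k ∈ Finset.range m, a k ω
      - ∑ k ∈ Finset.range m, n k - ∑ k ∈ Finset.range m, ξ k ω := by
    refine antitone_nat_of_succ_le fun m => ?_
    simp only [Finset.sum_range_succ]
    linarith [hω m]
  have hlow : BddBelow (Set.range fun m => W m ω + ∑ k ∈ Finset.range m, a k ω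
      - ∑ k ∈ Finset.range m, n k - ∑ k ∈ Finset.range m, ξ k ω) := by
    refine ⟨-(∑' k, n k) - B, ?_⟩
    rintro _ ⟨m, rfl⟩
    have h1 := hB (Set.mem_range_self m)
    have h2 : 0 ≤ ∑ k ∈ Finset.range m, a k ω := Finset.sum_nonneg fun k _ => ha k ω
    dsimp only
    linarith [hW m ω, hnle m]
  have hlim := tendsto_atTop_ciInf hanti hlow
  have := ((hlim.add hc).add hN).sub hsa.hasSum.tendsto_sum_nat
  refine ⟨_, this.congr fun m => ?_⟩
  ring

/-- The late start is needed because the one-step inequalities require `β ≤ 1/2`; time and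
filtration are shifted by `k₀`. -/
lemma ae_tendsto_and_summable_of_le_of_ge (ℱ : Filtration ℕ mΩ) {W a ξ : ℕ → Ω → ℝ} {n : ℕ → ℝ}
    (k₀ : ℕ) (hW : ∀ k ω, 0 ≤ W k ω) (ha : ∀ k ω, 0 ≤ a k ω) (hn0 : ∀ k, 0 ≤ n k)
    (hn : Summable n) (hW0 : Integrable (W k₀) μ)
    (hmeas : ∀ k, StronglyMeasurable[ℱ (k + 1)] (ξ k)) (hint : ∀ k, Integrable (ξ k) μ)
    (hzero : ∀ k, μ[ξ k | ℱ k] =ᵐ[μ] 0)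
    (hle : ∀ᵐ ω ∂μ, ∀ k ≥ k₀, W (k + 1) ω + a k ω ≤ W k ω + n k + ξ k ω) :
    ∀ᵐ ω ∂μ, (∃ c, Tendsto (fun k => W k ω) atTop (𝓝 c)) ∧ Summable fun k => a k ω := by
  have h := ae_tendsto_and_summable_of_le (μ := μ)
    ⟨fun k => ℱ (k₀ + k), fun i j hij => ℱ.mono (Nat.add_le_add_left hij k₀), fun k => ℱ.le _⟩
    (W := fun k => W (k₀ + k)) (a := fun k => a (k₀ + k)) (ξ := fun k => ξ (k₀ + k))
    (n := fun k => n (k₀ + k)) (fun k => hW _) (fun k => ha _) (fun k => hn0 _)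
    (by simpa only [add_comm k₀] using (summable_nat_add_iff k₀).2 hn) hW0
    (fun k => hmeas _) (fun k => hint _) (fun k => hzero _)
    (by filter_upwards [hle] with ω hω k using hω (k₀ + k) (Nat.le_add_right _ _))
  filter_upwards [h] with ω ⟨⟨c, hc⟩, hs⟩
  simp only [add_comm k₀] at hc hs
  exact ⟨⟨c, (tendsto_add_atTop_iff_nat k₀).1 hc⟩, (summable_nat_add_iff k₀).1 hs⟩

/-! ### Random quantization as bounded, conditionally unbiased noise. -/

lemma measurable_quantLower (b : ℕ) : Measurable (quantLower b) := by
  unfold quantLower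
  fun_prop

lemma measurable_quantUpper (b : ℕ) : Measurable (quantUpper b) :=
  (measurable_quantLower b).add_const _

lemma quantLower_lt_quantUpper (b : ℕ) (t : ℝ) : quantLower b t < quantUpper b t := by
  unfold quantUpper
  have : (0 : ℝ) < 1 / 2 ^ b := by positivity
  linarith

lemma quantLower_le (b : ℕ) (t : ℝ) : quantLower b t ≤ t := by
  unfold quantLower
  rw [div_le_iff₀ (by positivity), mul_comm t]
  exact Int.floor_le _

lemma le_quantUpper (b : ℕ) (t : ℝ) : t ≤ quantUpper b t := by
  unfold quantUpper quantLower
  rw [← add_div, le_div_iff₀ (by positivity), mul_comm t]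
  exact (Int.lt_floor_add_one _).le

lemma quantUpper_sub_quantLower_le_one (b : ℕ) (t : ℝ) : quantUpper b t - quantLower b t ≤ 1 := by
  unfold quantUpper
  rw [add_sub_cancel_left, div_le_one (by positivity)]
  exact one_le_pow₀ (by norm_num)

lemma quantUpper_sub_quantLower (b : ℕ) (t : ℝ) :
    quantUpper b t - quantLower b t = 1 / 2 ^ b := by
  unfold quantUpper
  ring

/-- The two ends of the cell exhaust the values of a random quantization. -/
lemma IsRandomQuantization.ae_eq_or (hm : m ≤ mΩ) {b : ℕ} {x q : Ω → ℝ}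
    (hx : Measurable x) (hq : Measurable q) (h : IsRandomQuantization μ m b x q) :
    ∀ᵐ ω ∂μ, q ω = quantUpper b (x ω) ∨ q ω = quantLower b (x ω) := by
  have hU : MeasurableSet {ω | q ω = quantUpper b (x ω)} :=
    measurableSet_eq_fun hq ((measurable_quantUpper b).comp hx)
  have hL : MeasurableSet {ω | q ω = quantLower b (x ω)} :=
    measurableSet_eq_fun hq ((measurable_quantLower b).comp hx)
  set U := {ω | q ω = quantUpper b (x ω)}
  set L := {ω | q ω = quantLower b (x ω)}
  have hdisj : Disjoint U L := Set.disjoint_left.2 fun ω hu hl =>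
    (quantLower_lt_quantUpper b (x ω)).ne (by
      rw [← (hl : q ω = quantLower b (x ω)), (hu : q ω = quantUpper b (x ω))])
  -- The two conditional probabilities add up to `2^b` times the cell width, which is one.
  have hsum : μ.real U + μ.real L = 1 := by
    have e1 : ∫ ω, U.indicator (fun _ => (1 : ℝ)) ω ∂μ = μ.real U := by
      simp [integral_indicator hU]
    have e2 : ∫ ω, L.indicator (fun _ => (1 : ℝ)) ω ∂μ = μ.real L := by
      simp [integral_indicator hL]
    rw [← e1, ← e2, ← integral_condExp hm, ← integral_condExp hm (f := L.indicator _),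
      ← integral_add integrable_condExp integrable_condExp]
    have : ∀ᵐ ω ∂μ, (μ[U.indicator fun _ => (1 : ℝ) | m]) ω
        + (μ[L.indicator fun _ => (1 : ℝ) | m]) ω = 1 := by
      filter_upwards [h.1, h.2] with ω h1 h2
      rw [h1, h2, ← mul_add]
      have := quantUpper_sub_quantLower b (x ω)
      rw [show x ω - quantLower b (x ω) + (quantUpper b (x ω) - x ω) = 1 / 2 ^ b by linarith]
      field_simp
    rw [integral_congr_ae this]
    simp
  rw [← measureReal_union hdisj hL] at hsum
  have : U ∪ L ∈ ae μ := by
    rw [mem_ae_iff, prob_compl_eq_zero_iff (hU.union hL)]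
    rw [measureReal_def] at hsum
    rw [← ENNReal.ofReal_toReal (measure_ne_top μ (U ∪ L)), hsum, ENNReal.ofReal_one]
  exact this

lemma IsRandomQuantization.ae_abs_sub_le_one (hm : m ≤ mΩ) {b : ℕ} {x q : Ω → ℝ}
    (hx : Measurable x) (hq : Measurable q) (h : IsRandomQuantization μ m b x q) :
    ∀ᵐ ω ∂μ, |q ω - x ω| ≤ 1 := by
  filter_upwards [h.ae_eq_or hm hx hq] with ω hω
  have h1 := quantUpper_sub_quantLower_le_one b (x ω)
  have h2 := quantLower_le b (x ω)
  have h3 := le_quantUpper b (x ω)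
  rcases hω with hω | hω <;> rw [hω, abs_le] <;> constructor <;> linarith

/-- A random quantization is unbiased. -/
lemma IsRandomQuantization.condExp_sub_eq_zero (hm : m ≤ mΩ) {b : ℕ} {x q : Ω → ℝ}
    (hx : StronglyMeasurable[m] x) (hq : Measurable q) (h : IsRandomQuantization μ m b x q) :
    μ[fun ω => q ω - x ω | m] =ᵐ[μ] 0 := by
  have hxΩ : Measurable x := (hx.mono hm).measurable
  have hU : MeasurableSet {ω | q ω = quantUpper b (x ω)} :=
    measurableSet_eq_fun hq ((measurable_quantUpper b).comp hxΩ)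
  have hL : MeasurableSet {ω | q ω = quantLower b (x ω)} :=
    measurableSet_eq_fun hq ((measurable_quantLower b).comp hxΩ)
  have hE := h.ae_eq_or hm hxΩ hq
  set U := {ω | q ω = quantUpper b (x ω)} with hUdef
  set L := {ω | q ω = quantLower b (x ω)} with hLdef
  have hIU : Integrable (U.indicator fun _ => (1 : ℝ)) μ := (integrable_const 1).indicator hU
  have hIL : Integrable (L.indicator fun _ => (1 : ℝ)) μ := (integrable_const 1).indicator hL
  set s : Ω → ℝ := fun ω => quantUpper b (x ω) - x ω with hs
  set r : Ω → ℝ := fun ω => quantLower b (x ω) - x ω with hr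
  have hsm : StronglyMeasurable[m] s :=
    (((measurable_quantUpper b).comp hx.measurable).stronglyMeasurable).sub hx
  have hrm : StronglyMeasurable[m] r :=
    (((measurable_quantLower b).comp hx.measurable).stronglyMeasurable).sub hx
  have hsb : ∀ ω, ‖s ω‖ ≤ 1 := fun ω => by
    rw [Real.norm_eq_abs, hs, abs_le]
    have h1 := quantUpper_sub_quantLower_le_one b (x ω)
    have h2 := quantLower_le b (x ω)
    have h3 := le_quantUpper b (x ω)
    constructor <;> dsimp only <;> linarith
  have hrb : ∀ ω, ‖r ω‖ ≤ 1 := fun ω => by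
    rw [Real.norm_eq_abs, hr, abs_le]
    have h1 := quantUpper_sub_quantLower_le_one b (x ω)
    have h2 := quantLower_le b (x ω)
    have h3 := le_quantUpper b (x ω)
    constructor <;> dsimp only <;> linarith
  -- With `u`, `l` the cell ends, `s = u - x` and `r = l - x` are bounded and known given `m`; the
  -- conditional mean becomes `2^b((u - x)(x - l) + (l - x)(u - x)) = 0`.
  have hdec : (fun ω => q ω - x ω) =ᵐ[μ]
      s * U.indicator (fun _ => (1 : ℝ)) + r * L.indicator (fun _ => (1 : ℝ)) := by
    filter_upwards [hE] with ω hω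
    have hlt := quantLower_lt_quantUpper b (x ω)
    rcases hω with hω | hω
    · have h1 : ω ∈ U := hω
      have h2 : ω ∉ L := fun h' : q ω = _ => by linarith
      simp [h1, h2, hs, hω]
    · have h1 : ω ∈ L := hω
      have h2 : ω ∉ U := fun h' : q ω = _ => by linarith
      simp [h1, h2, hr, hω]
  have hIs : Integrable (s * U.indicator (fun _ => (1 : ℝ))) μ :=
    hIU.bdd_mul (hsm.mono hm).aestronglyMeasurable (ae_of_all _ hsb)
  have hIr : Integrable (r * L.indicator (fun _ => (1 : ℝ))) μ :=
    hIL.bdd_mul (hrm.mono hm).aestronglyMeasurable (ae_of_all _ hrb)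
  filter_upwards [condExp_congr_ae hdec, condExp_add hIs hIr m,
    condExp_mul_of_stronglyMeasurable_left hsm hIs hIU,
    condExp_mul_of_stronglyMeasurable_left hrm hIr hIL, h.1, h.2] with ω h1 h2 h3 h4 h5 h6
  rw [h1, h2, Pi.add_apply, h3, h4, Pi.mul_apply, Pi.mul_apply, h5, h6, hs, hr]
  simp only [Pi.zero_apply]
  ring

variable {d : ℕ}

/-- Bounded noise with zero conditional mean is uncorrelated with the past. -/
lemma condExp_inner_eq_zero {h e : Ω → EuclideanSpace ℝ (Fin d)}
    (hh : StronglyMeasurable[m] h) (hhi : Integrable h μ) (hem : Measurable e)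
    {B : ℝ} (heB : ∀ᵐ ω ∂μ, ‖e ω‖ ≤ B)
    (he : ∀ c, μ[fun ω => e ω c | m] =ᵐ[μ] 0) :
    Integrable (fun ω => inner ℝ (h ω) (e ω)) μ ∧
      μ[fun ω => inner ℝ (h ω) (e ω) | m] =ᵐ[μ] 0 := by
  -- Expanding in coordinates is why only the conditional mean of each coordinate matters, not their
  -- joint law.
  have hinner : (fun ω => inner ℝ (h ω) (e ω)) =
      ∑ c, (fun ω => h ω c) * (fun ω => e ω c) := by
    ext ω
    simp [PiLp.inner_apply, mul_comm]
  have hc : ∀ c, StronglyMeasurable[m] fun ω => h ω c := fun c =>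
    (EuclideanSpace.proj c).continuous.comp_stronglyMeasurable hh
  have hec : ∀ c, Measurable fun ω => e ω c := fun c =>
    (EuclideanSpace.proj (𝕜 := ℝ) c).continuous.measurable.comp hem
  have hecB : ∀ c, ∀ᵐ ω ∂μ, ‖e ω c‖ ≤ B := fun c => by
    filter_upwards [heB] with ω hω using (PiLp.norm_apply_le (e ω) c).trans hω
  have hci : ∀ c, Integrable (fun ω => h ω c) μ := fun c =>
    (EuclideanSpace.proj (𝕜 := ℝ) c).integrable_comp hhi
  have heci : ∀ c, Integrable (fun ω => e ω c) μ := fun c =>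
    Integrable.of_bound (hec c).aestronglyMeasurable B (hecB c)
  have hprod : ∀ c, Integrable ((fun ω => h ω c) * (fun ω => e ω c)) μ := fun c =>
    (hci c).mul_bdd (hec c).aestronglyMeasurable (hecB c)
  rw [hinner]
  refine ⟨integrable_finsetSum' _ fun c _ => hprod c, ?_⟩
  refine (condExp_finsetSum (fun c _ => hprod c) m).trans ?_
  have : ∀ᵐ ω ∂μ, ∀ c, (μ[(fun ω => h ω c) * (fun ω => e ω c) | m]) ω = 0 := by
    rw [ae_all_iff]
    intro c
    filter_upwards [condExp_mul_of_stronglyMeasurable_left (hc c) (hprod c) (heci c), he c]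
      with ω h1 h2
    rw [h1, Pi.mul_apply, h2]
    simp
  filter_upwards [this] with ω hω
  simp [hω]

end Probability

/-! ### Deterministic limits: divergent stepsizes, weighted averages, Opial's argument. -/

section Limits

/-- If `φ ≥ δ` eventually, then `a ≤ δ⁻¹ a φ` eventually and `∑ a` would converge. -/
lemma frequently_lt_of_summable_mul {a φ : ℕ → ℝ} (ha : ∀ k, 0 < a k)
    (hsum : Summable fun k => a k * φ k)
    (hdiv : Tendsto (fun n => ∑ k ∈ Finset.range n, a k) atTop atTop) {δ : ℝ} (hδ : 0 < δ) :
    ∃ᶠ k in atTop, φ k < δ := by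
  intro hev
  refine (not_summable_iff_tendsto_nat_atTop_of_nonneg fun k => (ha k).le).2 hdiv ?_
  refine Summable.of_norm_bounded_eventually_nat (hsum.mul_left δ⁻¹) ?_
  filter_upwards [hev] with k hk
  rw [Real.norm_eq_abs, abs_of_pos (ha k), ← div_eq_inv_mul, le_div_iff₀ hδ]
  exact mul_le_mul_of_nonneg_left (not_lt.1 hk) (ha k).le

lemma tendsto_zero_of_summable_mul {a φ : ℕ → ℝ} (ha : ∀ k, 0 < a k) (hφ : ∀ k, 0 ≤ φ k)
    (hsum : Summable fun k => a k * φ k)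
    (hdiv : Tendsto (fun n => ∑ k ∈ Finset.range n, a k) atTop atTop)
    (hlim : ∃ c, Tendsto φ atTop (𝓝 c)) : Tendsto φ atTop (𝓝 0) := by
  obtain ⟨c, hc⟩ := hlim
  have h0 : 0 ≤ c := ge_of_tendsto' hc hφ
  rcases h0.eq_or_lt with rfl | hpos
  · exact hc
  · refine absurd (hc.eventually_const_lt (half_lt_self hpos)) ?_
    exact fun hev => frequently_lt_of_summable_mul ha hsum hdiv (half_pos hpos)
      (hev.mono fun k hk => not_lt.2 hk.le)

/-- Toeplitz's argument: the vanishing weights kill any fixed head, and on the tail `x` is already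
near `y`. -/
lemma tendsto_weighted_sum {E : Type*} [NormedAddCommGroup E] [NormedSpace ℝ E]
    {γ : ℕ → ℕ → ℝ} (hγ0 : ∀ k, ∀ t ≤ k, 0 ≤ γ k t)
    (hγ1 : ∀ k, ∑ t ∈ Finset.range (k + 1), γ k t = 1)
    (hγ : ∀ t, Tendsto (fun k => γ k t) atTop (𝓝 0)) {x : ℕ → E} {y : E}
    (hx : Tendsto x atTop (𝓝 y)) :
    Tendsto (fun k => ∑ t ∈ Finset.range (k + 1), γ k t • x t) atTop (𝓝 y) := by
  rw [tendsto_iff_norm_sub_tendsto_zero, Metric.tendsto_atTop]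
  intro δ hδ
  obtain ⟨T, hT⟩ := Metric.tendsto_atTop.1 hx (δ / 2) (half_pos hδ)
  have hfin : Tendsto (fun k => ∑ t ∈ Finset.range T, γ k t * ‖x t - y‖) atTop (𝓝 0) := by
    simpa using tendsto_finsetSum (Finset.range T) fun t _ => (hγ t).mul_const ‖x t - y‖
  obtain ⟨M, hM⟩ := eventually_atTop.1 (hfin.eventually_lt_const (half_pos hδ))
  refine ⟨max T M, fun k hk => ?_⟩
  have hTk : T ≤ k + 1 := (le_max_left T M).trans (hk.trans k.le_succ)
  have e : ∑ t ∈ Finset.range (k + 1), γ k t • x t - y =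
      ∑ t ∈ Finset.range (k + 1), γ k t • (x t - y) := by
    simp only [smul_sub, Finset.sum_sub_distrib, ← Finset.sum_smul, hγ1, one_smul]
  have hle : ‖∑ t ∈ Finset.range (k + 1), γ k t • (x t - y)‖ ≤
      ∑ t ∈ Finset.range (k + 1), γ k t * ‖x t - y‖ :=
    norm_sum_le_of_le _ fun t ht => by
      rw [norm_smul, Real.norm_of_nonneg (hγ0 k t (Nat.lt_succ_iff.1 (Finset.mem_range.1 ht)))]
  have htail : ∑ t ∈ Finset.Ico T (k + 1), γ k t * ‖x t - y‖ ≤ δ / 2 := by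
    calc _ ≤ ∑ t ∈ Finset.Ico T (k + 1), γ k t * (δ / 2) := Finset.sum_le_sum fun t ht => by
          obtain ⟨h1, h2⟩ := Finset.mem_Ico.1 ht
          refine mul_le_mul_of_nonneg_left ?_ (hγ0 k t (Nat.lt_succ_iff.1 h2))
          rw [← dist_eq_norm]
          exact (hT t h1).le
      _ ≤ ∑ t ∈ Finset.range (k + 1), γ k t * (δ / 2) :=
          Finset.sum_le_sum_of_subset_of_nonneg (fun t ht => by
            simp only [Finset.mem_Ico, Finset.mem_range] at *
            omega) fun t ht _ => mul_nonneg
              (hγ0 k t (Nat.lt_succ_iff.1 (Finset.mem_range.1 ht))) (half_pos hδ).le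
      _ = δ / 2 := by rw [← Finset.sum_mul, hγ1, one_mul]
  have hsplit := Finset.sum_range_add_sum_Ico (fun t => γ k t * ‖x t - y‖) hTk
  rw [Real.dist_eq, sub_zero, abs_norm, e]
  linarith [hM k ((le_max_right T M).trans hk)]

/-- Weights whose ratios to a divergent series of stepsizes are decreasing and asymptotically
constant forget every fixed time. -/
lemma tendsto_weight_zero {α : ℕ → ℝ} {γ : ℕ → ℕ → ℝ} (hα_pos : ∀ k, 0 < α k)
    (hα_sum : Tendsto (fun n => ∑ k ∈ Finset.range n, α k) atTop atTop)
    (hγ_pos : ∀ k, ∀ t ≤ k, 0 < γ k t)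
    (hγ_sum : ∀ k, ∑ t ∈ Finset.range (k + 1), γ k t = 1)
    (hγ_mono : ∀ k j, j < k → γ k (j + 1) / α (j + 1) ≤ γ k j / α j)
    (hγ_diff : Tendsto (fun k => γ k 0 / α 0 - γ k k / α k) atTop (𝓝 0)) (t : ℕ) :
    Tendsto (fun k => γ k t) atTop (𝓝 0) := by
  have hmono : ∀ k s t, s ≤ t → t ≤ k → γ k t / α t ≤ γ k s / α s := by
    intro k s t hst
    induction t, hst using Nat.le_induction with
    | base => exact fun _ => le_rfl
    | succ t _ ih => exact fun h => (hγ_mono k t h).trans (ih (Nat.le_of_succ_le h))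
  have hS : ∀ k, 0 < ∑ t ∈ Finset.range (k + 1), α t := fun k =>
    Finset.sum_pos (fun t _ => hα_pos t) Finset.nonempty_range_add_one
  -- The last ratio is the smallest, so its product with `∑ α t` is at most the total weight one.
  -- The vanishing difference then carries the limit to the first, largest ratio.
  have hlast : Tendsto (fun k => γ k k / α k) atTop (𝓝 0) := by
    refine squeeze_zero (fun k => (div_pos (hγ_pos k k le_rfl) (hα_pos k)).le) (fun k => ?_)
      (hα_sum.comp (tendsto_add_atTop_nat 1)).inv_tendsto_atTop
    simp only [Pi.inv_apply, Function.comp_apply]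
    rw [le_inv_comm₀ (div_pos (hγ_pos k k le_rfl) (hα_pos k)) (hS k), inv_eq_one_div,
      le_div_iff₀ (div_pos (hγ_pos k k le_rfl) (hα_pos k)), ← hγ_sum k, Finset.sum_mul]
    refine Finset.sum_le_sum fun t ht => ?_
    have := hmono k t k (Nat.lt_succ_iff.1 (Finset.mem_range.1 ht)) le_rfl
    rw [le_div_iff₀ (hα_pos t)] at this
    linarith
  have hfirst : Tendsto (fun k => α t * (γ k 0 / α 0)) atTop (𝓝 0) := by
    simpa using (hγ_diff.add hlast).const_mul (α t)
  refine tendsto_of_tendsto_of_tendsto_of_le_of_le' tendsto_const_nhds hfirst ?_ ?_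
  · filter_upwards [eventually_ge_atTop t] with k hk using (hγ_pos k t hk).le
  · filter_upwards [eventually_ge_atTop t] with k hk
    have := hmono k 0 t (Nat.zero_le _) hk
    rw [div_le_iff₀ (hα_pos t)] at this
    linarith

/-- An Opial type statement for several agents that reach consensus. -/
lemma exists_isMinOn_tendsto {V : Type*} [Fintype V] {d : ℕ}
    {X : Set (EuclideanSpace ℝ (Fin d))} (hX : IsClosed X) {F : EuclideanSpace ℝ (Fin d) → ℝ}
    (hF : ContinuousOn F X) {xstar : EuclideanSpace ℝ (Fin d)} (hxs : xstar ∈ X)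
    (hmin : IsMinOn F X xstar) {Y : Set (EuclideanSpace ℝ (Fin d))}
    (hY : {y | y ∈ X ∧ IsMinOn F X y} ⊆ closure Y)
    {x : V → ℕ → EuclideanSpace ℝ (Fin d)} (hx : ∀ i k, x i k ∈ X)
    (hlim : ∀ y ∈ Y, ∃ c, Tendsto (fun k => ∑ i, ‖x i k - y‖ ^ 2) atTop (𝓝 c))
    (hcons : Tendsto (fun k => disagreement fun i => x i k) atTop (𝓝 0)) (i₀ : V)
    (hfreq : ∀ δ > 0, ∃ᶠ k in atTop, F (x i₀ k) < F xstar + δ) :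
    ∃ y ∈ X, IsMinOn F X y ∧ ∀ i, Tendsto (x i) atTop (𝓝 y) := by
  have hle : ∀ (y : EuclideanSpace ℝ (Fin d)) i k, ‖x i k - y‖ ^ 2 ≤ ∑ i, ‖x i k - y‖ ^ 2 :=
    fun y i k => Finset.single_le_sum (f := fun i => ‖x i k - y‖ ^ 2)
      (fun _ _ => by positivity) (Finset.mem_univ i)
  obtain ⟨y₀, hy₀⟩ : Y.Nonempty := closure_nonempty_iff.1 ⟨xstar, hY ⟨hxs, hmin⟩⟩
  obtain ⟨c₀, hc₀⟩ := hlim y₀ hy₀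
  obtain ⟨B, hB⟩ := hc₀.bddAbove_range
  have hball : ∀ k, x i₀ k ∈ Metric.closedBall y₀ (√B) := fun k => by
    rw [Metric.mem_closedBall, dist_eq_norm]
    exact Real.le_sqrt_of_sq_le ((hle y₀ i₀ k).trans (hB (Set.mem_range_self k)))
  obtain ⟨φ, hφ, hφF⟩ := extraction_forall_of_frequently fun n : ℕ =>
    hfreq (1 / ((n : ℝ) + 1)) Nat.one_div_pos_of_nat
  obtain ⟨y, -, ψ, hψ, hy⟩ :=
    tendsto_subseq_of_bounded Metric.isBounded_closedBall fun n => hball (φ n)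
  have hyX : y ∈ X := hX.mem_of_tendsto hy (Eventually.of_forall fun n => hx _ _)
  have hθ : Tendsto (fun n => φ (ψ n)) atTop atTop := (hφ.comp hψ).tendsto_atTop
  have hFy : F y ≤ F xstar := by
    have h1 : Tendsto (fun n => F (x i₀ (φ (ψ n)))) atTop (𝓝 (F y)) :=
      (hF y hyX).tendsto.comp (tendsto_nhdsWithin_iff.2 ⟨hy, Eventually.of_forall fun n => hx _ _⟩)
    have h2 : Tendsto (fun n => F xstar + 1 / ((ψ n : ℝ) + 1)) atTop (𝓝 (F xstar)) := by
      simpa using ((tendsto_one_div_add_atTop_nhds_zero_nat (𝕜 := ℝ)).comp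
        hψ.tendsto_atTop).const_add (F xstar)
    exact le_of_tendsto_of_tendsto' h1 h2 fun n => (hφF (ψ n)).le
  have hymin : IsMinOn F X y := fun z hz => hFy.trans (hmin hz)
  have hdiff : ∀ i, Tendsto (fun k => x i k - x i₀ k) atTop (𝓝 0) := fun i => by
    rw [tendsto_zero_iff_norm_tendsto_zero]
    have h1 : Tendsto (fun k => √(disagreement fun i => x i k)) atTop (𝓝 0) := by
      simpa using hcons.sqrt
    exact squeeze_zero (fun _ => norm_nonneg _) (fun k => Real.le_sqrt_of_sq_le
      (sq_norm_sub_le_disagreement (fun i => x i k) i i₀)) h1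
  have hyi : ∀ i, Tendsto (fun n => x i (φ (ψ n))) atTop (𝓝 y) := fun i => by
    simpa using ((hdiff i).comp hθ).add hy
  refine ⟨y, hyX, hymin, fun i => ?_⟩
  rw [Metric.tendsto_atTop]
  intro δ hδ
  set N : ℝ := (Fintype.card V : ℝ)
  -- The cluster point `y` need not lie in `Y`, so it is replaced by a nearby `w ∈ Y`. The limit for
  -- `w` is `N * ‖y - w‖²`, strictly below `(N + 1) * η²`, and `√(N + 1) * η + η = δ`.
  set η : ℝ := δ / (√(N + 1) + 1) with hη
  have hη0 : 0 < η := by positivity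
  obtain ⟨w, hwY, hw⟩ := Metric.mem_closure_iff.1 (hY ⟨hyX, hymin⟩) η hη0
  obtain ⟨c, hc⟩ := hlim w hwY
  have hcw : c = N * ‖y - w‖ ^ 2 := by
    refine tendsto_nhds_unique (hc.comp hθ) ?_
    have := tendsto_finsetSum Finset.univ fun i (_ : i ∈ Finset.univ) =>
      (((hyi i).sub_const w).norm.pow 2)
    simpa [N, Function.comp_def] using this
  rw [dist_eq_norm] at hw
  have hclt : c < (N + 1) * η ^ 2 := by
    have h1 : ‖y - w‖ ^ 2 ≤ η ^ 2 := pow_le_pow_left₀ (norm_nonneg _) hw.le 2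
    have h2 : N * ‖y - w‖ ^ 2 ≤ N * η ^ 2 := mul_le_mul_of_nonneg_left h1 (Nat.cast_nonneg _)
    rw [hcw]
    nlinarith
  obtain ⟨M, hM⟩ := eventually_atTop.1 (hc.eventually_lt_const hclt)
  refine ⟨M, fun k hk => ?_⟩
  have h1 : ‖x i k - w‖ < √(N + 1) * η := by
    refine lt_of_pow_lt_pow_left₀ 2 (by positivity) ?_
    rw [mul_pow, Real.sq_sqrt (by positivity)]
    exact (hle w i k).trans_lt (hM k hk)
  rw [dist_eq_norm]
  calc ‖x i k - y‖ ≤ ‖x i k - w‖ + ‖w - y‖ := norm_sub_le_norm_sub_add_norm_sub _ _ _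
    _ < √(N + 1) * η + η := add_lt_add h1 (by rwa [norm_sub_rev])
    _ = δ := by rw [hη]; field_simp

end Limits

/-! ### Algebra of conditionally centered variables. -/

section Centered

variable {Ω : Type*} {m : MeasurableSpace Ω} [mΩ : MeasurableSpace Ω] {μ : Measure Ω}

/-- The random variable `η` is integrable, with conditional mean zero given `m`. -/
def IsCentered (μ : Measure Ω) (m : MeasurableSpace Ω) (η : Ω → ℝ) : Prop :=
  Integrable η μ ∧ μ[η | m] =ᵐ[μ] 0

lemma IsCentered.const_mul {η : Ω → ℝ} (h : IsCentered μ m η) (c : ℝ) :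
    IsCentered μ m fun ω => c * η ω := by
  refine ⟨h.1.const_mul c, ?_⟩
  filter_upwards [condExp_smul (μ := μ) c η m, h.2] with ω h1 h2
  have h1' : (μ[fun ω => c * η ω | m]) ω = c • (μ[η | m]) ω := h1
  simp [h1', h2]

lemma IsCentered.sub {η ζ : Ω → ℝ} (h : IsCentered μ m η) (h' : IsCentered μ m ζ) :
    IsCentered μ m fun ω => η ω - ζ ω := by
  refine ⟨h.1.sub h'.1, ?_⟩
  filter_upwards [condExp_sub h.1 h'.1 m, h.2, h'.2] with ω h1 h2 h3
  have h1' : (μ[fun ω => η ω - ζ ω | m]) ω = (μ[η | m]) ω - (μ[ζ | m]) ω := h1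
  simp [h1', h2, h3]

lemma IsCentered.sum {ι : Type*} [Fintype ι] {η : ι → Ω → ℝ} (h : ∀ i, IsCentered μ m (η i)) :
    IsCentered μ m fun ω => ∑ i, η i ω := by
  refine ⟨integrable_finsetSum _ fun i _ => (h i).1, ?_⟩
  have e : (fun ω => ∑ i, η i ω) = ∑ i, η i := by
    ext ω
    simp
  have h0 : ∀ᵐ ω ∂μ, ∀ i, (μ[η i | m]) ω = 0 := ae_all_iff.2 fun i => (h i).2
  rw [e]
  filter_upwards [condExp_finsetSum (fun i _ => (h i).1) m (s := Finset.univ), h0] with ω h1 h2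
  simp [h1, h2]

end Centered

/-! ### Runs of the algorithm as noisy averaging, and the resulting almost sure limits. -/

lemma sum_neighbors {V E : Type*} [Fintype V] [DecidableEq V] [NormedAddCommGroup E]
    [NormedSpace ℝ E] {link : V → V → Prop} {A : Matrix V V ℝ} (hA : IsWeightMatrix link A)
    (i : V) (v : V → E) : ∑ j ∈ neighbors link i, A i j • v j = ∑ j, A i j • v j := by
  refine Finset.sum_subset (Finset.subset_univ _) fun j _ hj => ?_
  have h : ¬ 0 < A i j := fun h => hj (by simp [neighbors, (hA.pos_iff i j).1 h])
  rw [le_antisymm (not_lt.1 h) (nonneg_of_mem_doublyStochastic hA.stochastic), zero_smul]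

/-- The quantization noise in the weighted mean that the agent `i` computes. -/
def noise {V E Ω : Type*} [Fintype V] [AddCommGroup E] [Module ℝ E] (A : Matrix V V ℝ)
    (x q : V → ℕ → Ω → E) (i : V) (k : ℕ) (ω : Ω) : E :=
  ∑ j, A i j • (q j k ω - x j k ω)

namespace IsRun

variable {V : Type*} [Fintype V] [DecidableEq V] {d : ℕ} {Ω : Type*} [mΩ : MeasurableSpace Ω]
  {μ : Measure Ω} [IsProbabilityMeasure μ] {ℱ : Filtration ℕ mΩ}
  {X : Set (EuclideanSpace ℝ (Fin d))} {f : V → EuclideanSpace ℝ (Fin d) → ℝ}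
  {link : V → V → Prop} {A : Matrix V V ℝ} {b : ℕ} {α β : ℕ → ℝ}
  {x q g : V → ℕ → Ω → EuclideanSpace ℝ (Fin d)} {G : ℝ}

omit [DecidableEq V] [IsProbabilityMeasure μ] in
lemma mem (h : IsRun μ ℱ X f link A b α β x q g) (i : V) (k : ℕ) (ω : Ω) : x i k ω ∈ X := by
  cases k with
  | zero => exact h.init_mem i ω
  | succ k => exact (h.step i k ω).1

omit [IsProbabilityMeasure μ] in
lemma step_mix (h : IsRun μ ℱ X f link A b α β x q g) (hA : IsWeightMatrix link A)
    (i : V) (k : ℕ) (ω : Ω) :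
    IsProjection X (mix A (β k) (fun j => x j k ω) i - α k • g i k ω + β k • noise A x q i k ω)
      (x i (k + 1) ω) := by
  have hs := h.step i k ω
  rw [sum_neighbors hA] at hs
  convert hs using 1
  simp only [mix, noise, smul_sub, Finset.sum_sub_distrib]
  abel

omit [DecidableEq V] [IsProbabilityMeasure μ] in
lemma stronglyMeasurable_noise (h : IsRun μ ℱ X f link A b α β x q g) (i : V) (k : ℕ) :
    StronglyMeasurable[ℱ (k + 1)] (noise A x q i k) :=
  Finset.stronglyMeasurable_fun_sum _ fun j _ =>
    ((h.measurable_q j k).sub ((h.measurable_x j k).mono (ℱ.mono k.le_succ))).const_smul (A i j)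

omit [DecidableEq V] in
lemma ae_norm_sub_le (h : IsRun μ ℱ X f link A b α β x q g) (j : V) (k : ℕ) :
    ∀ᵐ ω ∂μ, ‖q j k ω - x j k ω‖ ≤ √d := by
  have hc : ∀ᵐ ω ∂μ, ∀ c, |q j k ω c - x j k ω c| ≤ 1 := ae_all_iff.2 fun c =>
    (h.quantized j k c).ae_abs_sub_le_one (ℱ.le k)
      ((EuclideanSpace.proj (𝕜 := ℝ) c).continuous.measurable.comp
        ((h.measurable_x j k).mono (ℱ.le _)).measurable)
      ((EuclideanSpace.proj (𝕜 := ℝ) c).continuous.measurable.comp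
        ((h.measurable_q j k).mono (ℱ.le _)).measurable)
  filter_upwards [hc] with ω hω
  refine Real.le_sqrt_of_sq_le ?_
  rw [EuclideanSpace.norm_sq_eq]
  calc ∑ c, ‖(q j k ω - x j k ω) c‖ ^ 2 ≤ ∑ _c : Fin d, (1 : ℝ) :=
        Finset.sum_le_sum fun c _ => pow_le_one₀ (norm_nonneg _) (hω c)
    _ = d := by simp

lemma ae_norm_noise_le (h : IsRun μ ℱ X f link A b α β x q g) (hA : IsWeightMatrix link A)
    (i : V) (k : ℕ) : ∀ᵐ ω ∂μ, ‖noise A x q i k ω‖ ≤ √d := by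
  filter_upwards [ae_all_iff.2 fun j => h.ae_norm_sub_le j k] with ω hω
  calc ‖noise A x q i k ω‖ ≤ ∑ j, A i j * √d := norm_sum_le_of_le _ fun j _ => by
        rw [norm_smul, Real.norm_of_nonneg (nonneg_of_mem_doublyStochastic hA.stochastic)]
        exact mul_le_mul_of_nonneg_left (hω j) (nonneg_of_mem_doublyStochastic hA.stochastic)
    _ = √d := by rw [← Finset.sum_mul, sum_row_of_mem_doublyStochastic hA.stochastic, one_mul]

omit [DecidableEq V] in
lemma condExp_noise (h : IsRun μ ℱ X f link A b α β x q g) (i : V) (k : ℕ) (c : Fin d) :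
    μ[fun ω => noise A x q i k ω c | ℱ k] =ᵐ[μ] 0 := by
  have hj : ∀ j, IsCentered μ (ℱ k) fun ω => q j k ω c - x j k ω c := fun j => by
    have hx : StronglyMeasurable[ℱ k] fun ω => x j k ω c :=
      (EuclideanSpace.proj (𝕜 := ℝ) c).continuous.comp_stronglyMeasurable (h.measurable_x j k)
    have hq : Measurable fun ω => q j k ω c :=
      (EuclideanSpace.proj (𝕜 := ℝ) c).continuous.measurable.comp
        ((h.measurable_q j k).mono (ℱ.le _)).measurable
    have hxm := (hx.mono (ℱ.le k)).measurable
    exact ⟨Integrable.of_bound (hq.sub hxm).aestronglyMeasurable 1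
      ((h.quantized j k c).ae_abs_sub_le_one (ℱ.le k) hxm hq),
      (h.quantized j k c).condExp_sub_eq_zero (ℱ.le k) hx hq⟩
  have := (IsCentered.sum fun j => (hj j).const_mul (A i j)).2
  convert this using 3 with ω
  simp [noise]

/-- The iterates are square-integrable. -/
lemma memLp (h : IsRun μ ℱ X f link A b α β x q g) (hA : IsWeightMatrix link A)
    (hX : Convex ℝ X) (hG : ∀ i k ω, ‖g i k ω‖ ≤ G) {y : EuclideanSpace ℝ (Fin d)} (hy : y ∈ X)
    (k : ℕ) : ∀ i, MemLp (x i k) 2 μ := by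
  induction k with
  | zero => exact h.init_memLp
  | succ k ih =>
    intro i
    have hg : MemLp (g i k) 2 μ := MemLp.of_bound
      ((h.measurable_g i k).mono (ℱ.le k)).aestronglyMeasurable G (ae_of_all _ (hG i k))
    have hn : MemLp (noise A x q i k) 2 μ := MemLp.of_bound
      ((h.stronglyMeasurable_noise i k).mono (ℱ.le _)).aestronglyMeasurable _
      (h.ae_norm_noise_le hA i k)
    have hm : MemLp (fun ω => mix A (β k) (fun j => x j k ω) i) 2 μ :=
      ((ih i).const_smul (1 - β k)).add
        ((memLp_finsetSum _ fun j _ => (ih j).const_smul (A i j)).const_smul (β k))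
    have hv : MemLp (fun ω => mix A (β k) (fun j => x j k ω) i - α k • g i k ω
        + β k • noise A x q i k ω - y) 2 μ :=
      ((hm.sub (hg.const_smul (α k))).add (hn.const_smul (β k))).sub (memLp_const y)
    -- The point `y ∈ X` is its own projection, so nonexpansiveness transfers square-integrability
    -- through the projection.
    have hd : MemLp (fun ω => x i (k + 1) ω - y) 2 μ := by
      refine hv.mono (((h.measurable_x i (k + 1)).mono (ℱ.le _)).sub
        stronglyMeasurable_const).aestronglyMeasurable (ae_of_all _ fun ω => ?_)
      exact (h.step_mix hA i k ω).norm_sub_le hX (isProjection_self hy)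
    simpa [Pi.add_def] using hd.add (memLp_const y)

/-- The noiseless part of the update of the agent `i`, as a function of the history. -/
lemma drift_props (h : IsRun μ ℱ X f link A b α β x q g) (hA : IsWeightMatrix link A)
    (hX : Convex ℝ X) (hG : ∀ i k ω, ‖g i k ω‖ ≤ G) {y : EuclideanSpace ℝ (Fin d)} (hy : y ∈ X)
    (i : V) (k : ℕ) :
    StronglyMeasurable[ℱ k] (fun ω => mix A (β k) (fun j => x j k ω) i - α k • g i k ω) ∧
      Integrable (fun ω => mix A (β k) (fun j => x j k ω) i - α k • g i k ω) μ := by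
  have hi := fun j => (h.memLp hA hX hG hy k j).integrable one_le_two
  have hg : Integrable (g i k) μ := Integrable.of_bound
    ((h.measurable_g i k).mono (ℱ.le k)).aestronglyMeasurable G (ae_of_all _ (hG i k))
  constructor
  · exact (((h.measurable_x i k).const_smul (1 - β k)).add ((Finset.stronglyMeasurable_fun_sum _
      fun j _ => (h.measurable_x j k).const_smul (A i j)).const_smul (β k))).sub
      ((h.measurable_g i k).const_smul (α k))
  · exact (((hi i).smul (1 - β k)).add ((integrable_finsetSum _
      fun j _ => (hi j).smul (A i j)).smul (β k))).sub (hg.smul (α k))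

lemma isCentered_inner_noise (h : IsRun μ ℱ X f link A b α β x q g)
    (hA : IsWeightMatrix link A) {k : ℕ} {p : Ω → EuclideanSpace ℝ (Fin d)}
    (hp : StronglyMeasurable[ℱ k] p) (hpi : Integrable p μ) (i : V) :
    IsCentered μ (ℱ k) fun ω => inner ℝ (p ω) (noise A x q i k ω) :=
  condExp_inner_eq_zero hp hpi ((h.stronglyMeasurable_noise i k).mono (ℱ.le _)).measurable
    (h.ae_norm_noise_le hA i k) (h.condExp_noise i k)

/-- Almost surely, the distances of the agents to a minimizer have a limit, and the optimality gap
and the disagreement are summable against the stepsizes. -/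
lemma ae_tendsto_sum_sq_dist (h : IsRun μ ℱ X f link A b α β x q g)
    (hA : IsWeightMatrix link A) (hX : Convex ℝ X) (hG : ∀ i k ω, ‖g i k ω‖ ≤ G)
    {L : V → NNReal} (hf : ∀ i, LipschitzOnWith (L i) (f i) X)
    (hα : ∀ k, 0 < α k) (hβ : ∀ k, 0 < β k) (hβ_sq : Summable fun k => β k ^ 2)
    (hαβ : Summable fun k => α k ^ 2 / β k) {k₀ : ℕ} (hβ2 : ∀ k ≥ k₀, β k ≤ 1 / 2)
    {y : EuclideanSpace ℝ (Fin d)} (hy : y ∈ X) (hmin : ∀ z ∈ X, ∑ i, f i y ≤ ∑ i, f i z)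
    (i₀ : V) :
    ∀ᵐ ω ∂μ, (∃ c, Tendsto (fun k => ∑ i, ‖x i k ω - y‖ ^ 2) atTop (𝓝 c)) ∧
      (Summable fun k => α k * ∑ i, (f i (x i₀ k ω) - f i y)) ∧
      Summable fun k => β k * disagreement fun i => x i k ω := by
  obtain ⟨K, hK, hKx⟩ := exists_disagreement_le (E := EuclideanSpace ℝ (Fin d)) hA
  set C : ℝ := ∑ i, (3 * G ^ 2 + 8 * K * (L i : ℝ) ^ 2)
  have hC : 0 ≤ C := Finset.sum_nonneg fun i _ => by positivity
  have hgap : ∀ k ω, 0 ≤ ∑ i, (f i (x i₀ k ω) - f i y) := fun k ω => by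
    rw [Finset.sum_sub_distrib, sub_nonneg]
    exact hmin _ (h.mem i₀ k ω)
  have hgap' : ∀ k ω, 0 ≤ 2 * α k * ∑ i, (f i (x i₀ k ω) - f i y) := fun k ω =>
    mul_nonneg (by linarith [hα k]) (hgap k ω)
  have hlink : ∀ k ω, 0 ≤ β k / 4 * linkDisagreement A fun i => x i k ω := fun k ω =>
    mul_nonneg (by linarith [hβ k]) (linkDisagreement_nonneg hA.stochastic _)
  have hp := h.drift_props hA hX hG hy
  have key := ae_tendsto_and_summable_of_le_of_ge (μ := μ) ℱ k₀
    (W := fun k ω => ∑ i, ‖x i k ω - y‖ ^ 2)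
    (a := fun k ω => 2 * α k * ∑ i, (f i (x i₀ k ω) - f i y)
      + β k / 4 * linkDisagreement A fun i => x i k ω)
    (ξ := fun k ω => 2 * β k * ∑ i,
      inner ℝ (mix A (β k) (fun j => x j k ω) i - α k • g i k ω - y) (noise A x q i k ω))
    (n := fun k => C * (α k ^ 2 / β k) + β k ^ 2 * (Fintype.card V * d))
    (fun k ω => Finset.sum_nonneg fun _ _ => by positivity)
    (fun k ω => add_nonneg (hgap' k ω) (hlink k ω))
    (fun k => by have := hβ k; positivity)
    ((hαβ.mul_left C).add (hβ_sq.mul_right _))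
    (integrable_finsetSum _ fun i _ =>
      ((h.memLp hA hX hG hy k₀ i).sub (memLp_const y)).integrable_norm_pow two_ne_zero)
    (fun k => (Finset.stronglyMeasurable_fun_sum _ fun i _ =>
      (((hp i k).1.sub stronglyMeasurable_const).mono (ℱ.mono k.le_succ)).inner
        (h.stronglyMeasurable_noise i k)).const_mul _)
    (fun k => ((IsCentered.sum fun i => h.isCentered_inner_noise hA
      ((hp i k).1.sub stronglyMeasurable_const)
      ((hp i k).2.sub (integrable_const y)) i).const_mul _).1)
    (fun k => ((IsCentered.sum fun i => h.isCentered_inner_noise hA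
      ((hp i k).1.sub stronglyMeasurable_const)
      ((hp i k).2.sub (integrable_const y)) i).const_mul _).2)
    (by
      filter_upwards [ae_all_iff.2 fun k => ae_all_iff.2 fun i => h.ae_norm_noise_le hA i k]
        with ω hω k hk
      have hs := sum_sq_dist_step_le hX hA hK hKx hf (hα k) (hβ k) (hβ2 k hk)
        (fun i => h.mem i k ω) (fun i => h.subgradient i k ω) (fun i => hG i k ω)
        (fun i => h.step_mix hA i k ω) hy i₀
      have hb : ∑ i, ‖noise A x q i k ω‖ ^ 2 ≤ Fintype.card V * d := by
        calc _ ≤ ∑ _i : V, (d : ℝ) := Finset.sum_le_sum fun i _ => by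
              simpa using pow_le_pow_left₀ (norm_nonneg _) (hω k i) 2
          _ = _ := by simp
      have := mul_le_mul_of_nonneg_left hb (sq_nonneg (β k))
      linarith)
  filter_upwards [key] with ω ⟨hc, hs⟩
  refine ⟨hc, ?_, ?_⟩
  · refine Summable.of_nonneg_of_le (fun k => mul_nonneg (hα k).le (hgap k ω)) (fun k => ?_) hs
    have h1 := mul_nonneg (hα k).le (hgap k ω)
    have h2 := hlink k ω
    linarith
  · refine Summable.of_nonneg_of_le (fun k => mul_nonneg (hβ k).le (disagreement_nonneg _))
      -- The factor `4 * K` undoes the `1/4` in the decrement and the comparison of disagreement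
      -- with link disagreement.
      (fun k => ?_) (hs.mul_left (4 * K))
    have h1 := mul_le_mul_of_nonneg_left (hKx fun i => x i k ω) (hβ k).le
    have h2 := mul_nonneg (by positivity : 0 ≤ 4 * K) (hgap' k ω)
    linarith

/-- Almost surely, the disagreement has a limit. -/
lemma ae_tendsto_disagreement [Nonempty V] (h : IsRun μ ℱ X f link A b α β x q g)
    (hA : IsWeightMatrix link A) (hX : Convex ℝ X) (hG : ∀ i k ω, ‖g i k ω‖ ≤ G)
    (hα : ∀ k, 0 < α k) (hβ : ∀ k, 0 < β k) (hβ_sq : Summable fun k => β k ^ 2)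
    (hαβ : Summable fun k => α k ^ 2 / β k) {k₀ : ℕ} (hβ2 : ∀ k ≥ k₀, β k ≤ 1 / 2)
    {y : EuclideanSpace ℝ (Fin d)} (hy : y ∈ X) :
    ∀ᵐ ω ∂μ, ∃ c, Tendsto (fun k => disagreement fun i => x i k ω) atTop (𝓝 c) := by
  obtain ⟨K, hK, hKx⟩ := exists_disagreement_le (E := EuclideanSpace ℝ (Fin d)) hA
  set C : ℝ := Fintype.card V ^ 2 * (4 * G ^ 2 * K / Fintype.card V + 2 * G ^ 2)
  have hC : 0 ≤ C := by positivity
  have hp := h.drift_props hA hX hG hy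
  have hL2 := h.memLp hA hX hG hy
  have hcent : ∀ k, IsCentered μ (ℱ k) fun ω => 2 * β k * ∑ i, ∑ j,
      inner ℝ ((mix A (β k) (fun l => x l k ω) i - α k • g i k ω)
        - (mix A (β k) (fun l => x l k ω) j - α k • g j k ω))
        (noise A x q i k ω - noise A x q j k ω) := fun k => by
    simp only [inner_sub_right]
    exact (IsCentered.sum fun i => IsCentered.sum fun j =>
      (h.isCentered_inner_noise hA ((hp i k).1.sub (hp j k).1) ((hp i k).2.sub (hp j k).2) i).sub
      (h.isCentered_inner_noise hA ((hp i k).1.sub (hp j k).1)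
        ((hp i k).2.sub (hp j k).2) j)).const_mul _
  have key := ae_tendsto_and_summable_of_le_of_ge (μ := μ) ℱ k₀
    -- No decrement is kept: only convergence is sought here, as summability against `β` comes from
    -- `ae_tendsto_sum_sq_dist`.
    (W := fun k ω => disagreement fun i => x i k ω) (a := fun _ _ => 0)
    (ξ := fun k ω => 2 * β k * ∑ i, ∑ j,
      inner ℝ ((mix A (β k) (fun l => x l k ω) i - α k • g i k ω)
        - (mix A (β k) (fun l => x l k ω) j - α k • g j k ω))
        (noise A x q i k ω - noise A x q j k ω))
    (n := fun k => C * (α k ^ 2 / β k) + β k ^ 2 * (Fintype.card V * (Fintype.card V * (4 * d))))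
    (fun k ω => disagreement_nonneg _) (fun _ _ => le_rfl)
    (fun k => by have := hβ k; positivity)
    ((hαβ.mul_left C).add (hβ_sq.mul_right _))
    (integrable_finsetSum _ fun i _ => integrable_finsetSum _ fun j _ =>
      ((hL2 k₀ i).sub (hL2 k₀ j)).integrable_norm_pow two_ne_zero)
    (fun k => (Finset.stronglyMeasurable_fun_sum _ fun i _ =>
      Finset.stronglyMeasurable_fun_sum _ fun j _ =>
      (((hp i k).1.sub (hp j k).1).mono (ℱ.mono k.le_succ)).inner
        ((h.stronglyMeasurable_noise i k).sub (h.stronglyMeasurable_noise j k))).const_mul _)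
    (fun k => (hcent k).1) (fun k => (hcent k).2)
    (by
      filter_upwards [ae_all_iff.2 fun k => ae_all_iff.2 fun i => h.ae_norm_noise_le hA i k]
        with ω hω k hk
      have hs := disagreement_step_le hX hA hK hKx (hα k) (hβ k) (hβ2 k hk)
        (fun i => hG i k ω) (fun i => h.step_mix hA i k ω)
      have hb : disagreement (fun i => noise A x q i k ω) ≤
          Fintype.card V * (Fintype.card V * (4 * d)) := by
        calc _ ≤ ∑ _i : V, ∑ _j : V, (4 * d : ℝ) :=
              Finset.sum_le_sum fun i _ => Finset.sum_le_sum fun j _ => by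
                have h1 : ‖noise A x q i k ω - noise A x q j k ω‖ ≤ 2 * √d :=
                  (norm_sub_le _ _).trans (by linarith [hω k i, hω k j])
                refine (pow_le_pow_left₀ (norm_nonneg _) h1 2).trans_eq ?_
                rw [mul_pow, Real.sq_sqrt (Nat.cast_nonneg d)]
                norm_num
          _ = _ := by simp
      have := mul_le_mul_of_nonneg_left hb (sq_nonneg (β k))
      linarith)
  filter_upwards [key] with ω hω using hω.1

end IsRun

end GDSRQ

/-! ### Assembly of the theorem. -/

lemma GDSRQ.continuousOn_objective {V : Type*} [Fintype V] {d : ℕ}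
    {X : Set (EuclideanSpace ℝ (Fin d))} {f : V → EuclideanSpace ℝ (Fin d) → ℝ} {L : V → NNReal}
    (hf : ∀ i, LipschitzOnWith (L i) (f i) X) : ContinuousOn (objective f) X :=
  continuousOn_const.mul (continuousOn_finsetSum _ fun i _ => (hf i).continuousOn)

theorem proposition1
    {V : Type*} [Fintype V] [DecidableEq V] {d : ℕ}
    {Ω : Type*} [mΩ : MeasurableSpace Ω] (μ : Measure Ω) [IsProbabilityMeasure μ]
    (ℱ : Filtration ℕ mΩ)
    -- the problem: constraint set, network, Lipschitz local functions, convex average, a minimizer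
    (X : Set (EuclideanSpace ℝ (Fin d))) (hX_closed : IsClosed X) (hX_convex : Convex ℝ X)
    (link : V → V → Prop) (A : Matrix V V ℝ) (hA : GDSRQ.IsWeightMatrix link A)
    (f : V → EuclideanSpace ℝ (Fin d) → ℝ) (L : V → NNReal)
    (hf_lip : ∀ i, LipschitzOnWith (L i) (f i) X)
    (hf_convex : ConvexOn ℝ X (GDSRQ.objective f))
    (xstar : EuclideanSpace ℝ (Fin d)) (hxstar : xstar ∈ X)
    (hmin : IsMinOn (GDSRQ.objective f) X xstar)
    -- the stepsizes
    (α β : ℕ → ℝ) (hα_pos : ∀ k, 0 < α k) (hβ_pos : ∀ k, 0 < β k)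
    (hα_anti : Antitone α) (hβ_anti : Antitone β)
    (hkβ : Tendsto (fun k : ℕ => (k : ℝ) * β k) atTop atTop)
    (C : ℝ) (hC : 0 < C)
    (hkα : ∃ l ≤ C, Tendsto (fun k : ℕ => 1 / ((k : ℝ) * α k)) atTop (𝓝 l))
    (hβ_sq : Summable fun k => β k ^ 2)
    (hαβ : Summable fun k => α k ^ 2 / β k)
    (hα_sum : Tendsto (fun n => ∑ k ∈ Finset.range n, α k) atTop atTop)
    (hβ_sum : Tendsto (fun n => ∑ k ∈ Finset.range n, β k) atTop atTop)
    -- a run of the algorithm, with bounded subgradients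
    (b : ℕ) (x q g : V → ℕ → Ω → EuclideanSpace ℝ (Fin d))
    (hrun : GDSRQ.IsRun μ ℱ X f link A b α β x q g)
    (G : ℝ) (hG : ∀ i k ω, ‖g i k ω‖ ≤ G)
    -- the averaging weights `γ k t`, for `t ≤ k`
    (γ : ℕ → ℕ → ℝ) (hγ_pos : ∀ k, ∀ t ≤ k, 0 < γ k t)
    (hγ_sum : ∀ k, ∑ t ∈ Finset.range (k + 1), γ k t = 1)
    (hγβ : Tendsto (fun k => ∑ t ∈ Finset.range (k + 1), γ k t / α t * β t ^ 2) atTop (𝓝 0))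
    (hγα : Tendsto (fun k => ∑ t ∈ Finset.range (k + 1), γ k t * α t / β t) atTop (𝓝 0))
    (hγ_mono : ∀ k j, j < k → γ k (j + 1) / α (j + 1) ≤ γ k j / α j)
    (hγ_diff : Tendsto (fun k => γ k 0 / α 0 - γ k k / α k) atTop (𝓝 0)) :
    -- almost surely, all averages converge to one common minimizer, which is `xstar` if `xstar`
    -- is the only one
    (∀ᵐ ω ∂μ, ∃ y ∈ X, IsMinOn (GDSRQ.objective f) X y ∧
      ∀ i, Tendsto (fun k => GDSRQ.timeAverage γ (x i) k ω) atTop (𝓝 y)) ∧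
    ((∀ y ∈ X, IsMinOn (GDSRQ.objective f) X y → y = xstar) →
      ∀ᵐ ω ∂μ, ∀ i, Tendsto (fun k => GDSRQ.timeAverage γ (x i) k ω) atTop (𝓝 xstar)) := by
  have hV : Nonempty V := hA.connected.nonempty
  have hN : (0 : ℝ) < Fintype.card V := by exact_mod_cast Fintype.card_pos
  obtain ⟨i₀⟩ := id hV
  obtain ⟨k₀, hk₀⟩ : ∃ k₀, ∀ k ≥ k₀, β k ≤ 1 / 2 := by
    have h := hβ_sq.tendsto_atTop_zero
    obtain ⟨k₀, hk₀⟩ := eventually_atTop.1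
      (h.eventually_lt_const (by norm_num : (0 : ℝ) < (1 / 2) ^ 2))
    exact ⟨k₀, fun k hk => (lt_of_pow_lt_pow_left₀ 2 (by norm_num) (hk₀ k hk)).le⟩
  have hsum_le : ∀ y, IsMinOn (GDSRQ.objective f) X y → ∀ z ∈ X, ∑ i, f i y ≤ ∑ i, f i z :=
    fun y hy z hz => le_of_mul_le_mul_left (hy hz) (one_div_pos.2 hN)
  -- Countability of `Y` gives one null set for all its points; density suffices for Opial's
  -- argument.
  obtain ⟨Y, hYsub, hYc, hYd⟩ := (TopologicalSpace.IsSeparable.of_separableSpace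
    {y | y ∈ X ∧ IsMinOn (GDSRQ.objective f) X y}).exists_countable_dense_subset
  have hdist : ∀ y, y ∈ X ∧ IsMinOn (GDSRQ.objective f) X y → _ := fun y hy =>
    hrun.ae_tendsto_sum_sq_dist hA hX_convex hG hf_lip hα_pos hβ_pos hβ_sq hαβ hk₀ hy.1
      (hsum_le y hy.2) i₀
  have hmain : ∀ᵐ ω ∂μ, ∃ y ∈ X, IsMinOn (GDSRQ.objective f) X y ∧
      ∀ i, Tendsto (fun k => GDSRQ.timeAverage γ (x i) k ω) atTop (𝓝 y) := by
    filter_upwards [hdist xstar ⟨hxstar, hmin⟩,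
      hrun.ae_tendsto_disagreement hA hX_convex hG hα_pos hβ_pos hβ_sq hαβ hk₀ hxstar,
      (ae_ball_iff hYc).2 fun y hy => hdist y (hYsub hy)] with ω ⟨_, hgap, hdis⟩ hconv hY
    have hcons := GDSRQ.tendsto_zero_of_summable_mul hβ_pos
      (fun k => GDSRQ.disagreement_nonneg _) hdis hβ_sum hconv
    obtain ⟨y, hyX, hymin, hy⟩ := GDSRQ.exists_isMinOn_tendsto hX_closed
      (GDSRQ.continuousOn_objective hf_lip) hxstar hmin hYd (x := fun i k => x i k ω)
      (fun i k => hrun.mem i k ω) (fun y hy => (hY y hy).1) hcons i₀ (fun δ hδ => by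
        refine (GDSRQ.frequently_lt_of_summable_mul hα_pos hgap hα_sum
          (mul_pos hN hδ)).mono fun k hk => ?_
        rw [Finset.sum_sub_distrib] at hk
        have h1 : ∑ i, f i (x i₀ k ω) < ∑ i, f i xstar + Fintype.card V * δ := by linarith
        have h2 := mul_lt_mul_of_pos_left h1 (one_div_pos.2 hN)
        rw [mul_add, ← mul_assoc, one_div_mul_cancel hN.ne', one_mul] at h2
        exact h2)
    exact ⟨y, hyX, hymin, fun i => GDSRQ.tendsto_weighted_sum
      (fun k t ht => (hγ_pos k t ht).le) hγ_sum
      (GDSRQ.tendsto_weight_zero hα_pos hα_sum hγ_pos hγ_sum hγ_mono hγ_diff) (hy i)⟩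
  refine ⟨hmain, fun huniq => ?_⟩
  filter_upwards [hmain] with ω ⟨y, hyX, hymin, hy⟩
  exact huniq y hyX hymin ▸ hy
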